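/- **Setting.** Let $X=\bigoplus_{j\in\frac12\mathbb Z}X^j\neq 0$ be a finite-dimensional graded real symplectic space with form $\sigma$, where $\sigma(X^i,X^j)=0$ for $i+j\ne 0$, and let $\delta=\mathbb R F$, where $F\in\mathfrak{csp}(X)$ has degree $-1$. Assume that $\delta$ is of Jacobi type, i.e. $(X,\sigma,F)$ is, for some representative $F$ of the line, an orthogonal direct sum of * finitely many blocks $\delta_{s,l}$ ($s,l$ integers, $s\ge 0$, $0\le l\le 2s$), with basis $e_{s-l},\dots,e_s,f_{-s},\dots,f_{l-s}$ (the index is the degree), $F e_i=e_{i-1}$, $F f_i=f_{i-1}$ (zero if there is no such vector), $\sigma(e_i,e_j)=\sigma(f_i,f_j)=0$, $\sigma(e_i,f_{-i})=(-1)^{s-i}$ and $\sigma(e_i,f_j)=0$ for $j\neq -i$; and * at most one block $\tau_m$ ($m\in\frac12+\mathbb Z$, $m>0$), with basis $\varepsilon_{-m},\dots,\varepsilon_m$, $F\varepsilon_i=\varepsilon_{i-1}$ (zero if $i=-m$), $\sigma(\varepsilon_i,\varepsilon_{-i})=(-1)^{m-i}$ and $\sigma(\varepsilon_i,\varepsilon_j)=0$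 for $j\neq -i$. Fix such a decomposition. The *skew Young diagram* of $\delta$ has columns indexed by degree, decreasing from left to right, and a row of consecutive boxes for each of the strings $(e_i)$, $(f_i)$, $(\varepsilon_i)$. Let $L_\rho\subset X$ be the span of the row $\rho$. **The algebra $\mathfrak u^F(\delta)$.** Let $\mathfrak{csp}^k(X)$ be the set of elements of degree $k$ in $\mathfrak{csp}(X)$, $k\in\frac12\mathbb Z$. Put $\mathfrak u^F_{-1}=\delta$, $\mathfrak u^F_{-1/2}=0$, $\mathfrak u^F_k=\{v\in\mathfrak{csp}^k(X):[v,\delta]\subset\mathfrak u^F_{k-1}\}$ for $k\in\frac12\mathbb Z_{\ge 0}$, and $\mathfrak u^F(\delta)=\bigoplus_{k\ge -1}\mathfrak u^F_k$. **The subspace $\mathfrak p$.** Let $\mathfrak{sl}_2$ act on $X$ so that each $L_\rho$ is an irreducible graded submodule, with lowering operator $F$, weight operator of degree $0$ and raising operator of degree $1$; this embeds $\mathfrak{sl}_2$ in $\mathfrak{sp}(X)$. Let $\mathfrak l(X)$ be the largest $\mathfrak{sl}_2$-submodule of $\mathfrak{sp}(X)$ concentrated in nonnegative degrees, and let $\mathfrak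 p=\pi_2(\mathfrak l(X))$, where $\pi_2$ is the projection of $\mathfrak{gl}(X)=\bigoplus_\rho\mathfrak{gl}(L_\rho)\oplus\bigoplus_{\rho\ne\rho'}\mathrm{Hom}(L_\rho,L_{\rho'})$ onto the second summand. **Prolongations.** Let $\eta=\eta^{-1}\oplus\eta^{-2}$ be the Heisenberg algebra: $\eta^{-1}=X$, $\eta^{-2}=\mathbb R z$ is central, and $[v,w]=\sigma(v,w)z$ for $v,w\in X$. Put $\mathfrak u^j=\eta^j$ for $j=-1,-2$, and let $\mathfrak u^0=\mathfrak u^F(\delta)$, acting on $\eta$ by grading-preserving derivations. For $i>0$ let $\mathfrak u^i=\mathfrak u^i(\eta,\mathfrak u^F(\delta))$ be the space of all $f\in\mathrm{Hom}(\eta^{-1},\mathfrak u^{i-1})\oplus\mathrm{Hom}(\eta^{-2},\mathfrak u^{i-2})$ with $f([y_1,y_2])=[f(y_1),y_2]+[y_1,f(y_2)]$ for all $y_1,y_2\in\eta$, where $[g,y]=-[y,g]=g(y)$ for $g\in\mathfrak u^j$, $j\ge0$, $y\in\eta$. The standard prolongation $\mathfrak p^{(i)}$ is the space of symmetric $(i+1)$-linear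 maps $t:X^{i+1}\to X$ such that $t(v_1,\dots,v_i,\cdot)\in\mathfrak p$ for all $v_1,\dots,v_i\in X$. **Theorem.** Assume that 1. the diagram does not contain two different rows such that the leftmost box of one lies in the same column as, or to the right of, the rightmost box of the other; 2. the diagram does not consist of a single row with two boxes; 3. every row indexed by $\mathbb Z$ (a row of some $\delta_{s,l}$) has at least $4$ boxes; 4. the row indexed by $\frac12+\mathbb Z$ (the row of $\tau_m$), if it exists, has at least $6$ boxes. Then for every $i>0$ the $i$-th Tanaka prolongation $\mathfrak u^i(\eta,\mathfrak u^F(\delta))$ coincides with the standard prolongation $\mathfrak p^{(i)}$. Precisely, the map sending $f\in\mathfrak u^i$ to its iterated restriction $(v_1,\dots,v_{i+1})\mapsto f(v_1)(v_2)\cdots(v_{i+1})$ to $X=\eta^{-1}$ is injective on $\mathfrak u^i$ and its image is $\mathfrak p^{(i)}$. -/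

import Mathlib

namespace JacobiSymbol

universe u

section Symplectic

variable {X : Type u} [AddCommGroup X] [Module ℝ X]

/-- The symplectic algebra `𝔰𝔭(X)`. -/
def sp (σ : LinearMap.BilinForm ℝ X) : Submodule ℝ (Module.End ℝ X) where
  carrier := {A | ∀ x y, σ (A x) y + σ x (A y) = 0}
  zero_mem' := by intro x y; simp
  add_mem' := by
    intro A B hA hB x y
    have h1 := hA x y
    have h2 := hB x y
    simp only [LinearMap.add_apply, map_add]
    linarith
  smul_mem' := by
    intro c A hA x y
    have h1 := hA x y
    simp only [LinearMap.smul_apply, map_smul, smul_eq_mul]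
    linear_combination c * h1

/-- The conformal symplectic algebra `𝔠𝔰𝔭(X)`. -/
def csp (σ : LinearMap.BilinForm ℝ X) : Submodule ℝ (Module.End ℝ X) where
  carrier := {A | ∃ c : ℝ, ∀ x y, σ (A x) y + σ x (A y) = c * σ x y}
  zero_mem' := ⟨0, by intro x y; simp⟩
  add_mem' := by
    rintro A B ⟨c, hA⟩ ⟨d, hB⟩
    refine ⟨c + d, fun x y => ?_⟩
    have h1 := hA x y
    have h2 := hB x y
    simp only [LinearMap.add_apply, map_add]
    linarith
  smul_mem' := by
    rintro a A ⟨c, hA⟩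
    refine ⟨a * c, fun x y => ?_⟩
    have h1 := hA x y
    simp only [LinearMap.smul_apply, map_smul, smul_eq_mul]
    linear_combination a * h1

/-! Gradings by `½ℤ` are indexed by the doubled weight: `G d` is the component of weight `d / 2`.
A space graded by `ℤ` (or by `½ + ℤ`) is one with `G d = 0` for odd (or for even) `d`. -/

/-- Endomorphisms of degree `k / 2`: they send weight `d / 2` to weight `(d + k) / 2`. -/
def homDeg (G : ℤ → Submodule ℝ X) (k : ℤ) : Submodule ℝ (Module.End ℝ X) where
  carrier := {A | ∀ d, ∀ x ∈ G d, A x ∈ G (d + k)}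
  zero_mem' := by intro d x _; simp
  add_mem' := by
    intro A B hA hB d x hx
    exact (G (d + k)).add_mem (hA d x hx) (hB d x hx)
  smul_mem' := by
    intro c A hA d x hx
    exact (G (d + k)).smul_mem c (hA d x hx)

/-- Endomorphisms all of whose homogeneous parts have nonnegative degree. -/
def nonnegDeg (G : ℤ → Submodule ℝ X) : Submodule ℝ (Module.End ℝ X) :=
  ⨆ k : ℕ, homDeg G k

/-- `σ` and `G` make `X` a graded (conformal) symplectic space, and `δ` is a symplectic flag symbol
on it: the line spanned by an endomorphism of degree `-1` that lies in `𝔠𝔰𝔭(X)`. -/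
structure IsSymplecticFlagSymbol (σ : LinearMap.BilinForm ℝ X) (G : ℤ → Submodule ℝ X)
    (δ : Submodule ℝ (Module.End ℝ X)) : Prop where
  alt : σ.IsAlt
  nondegenerate : σ.Nondegenerate
  internal : DirectSum.IsInternal G
  orthogonal : ∀ i j, i + j ≠ 0 → ∀ x ∈ G i, ∀ y ∈ G j, σ x y = 0
  line : ∃ A ∈ csp σ ⊓ homDeg G (-2), δ = Submodule.span ℝ {A}

/-- All `v` with `[v, δ] ⊆ S`, where `[v, x] = v x - x v`. -/
def bracketInto (δ S : Submodule ℝ (Module.End ℝ X)) : Submodule ℝ (Module.End ℝ X) where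
  carrier := {v | ∀ x ∈ δ, v * x - x * v ∈ S}
  zero_mem' := by intro x _; simp
  add_mem' := by
    intro v w hv hw x hx
    have h := S.add_mem (hv x hx) (hw x hx)
    rwa [sub_add_sub_comm, ← add_mul, ← mul_add] at h
  smul_mem' := by
    intro c v hv x hx
    have h := S.smul_mem c (hv x hx)
    rwa [smul_sub, ← smul_mul_assoc, ← mul_smul_comm] at h

/-- The algebraic prolongations of `δ` in `𝔠𝔰𝔭(X)`; the index `n` stands for the degree `n / 2 - 1`:
degree `-1` is `δ`, degree `-1/2` is `0`, and degree `k ≥ 0` consists of the `v ∈ 𝔠𝔰𝔭ᵏ(X)` such that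
`[v, δ]` lies in the part of degree `k - 1`. -/
def flagProlong (σ : LinearMap.BilinForm ℝ X) (G : ℤ → Submodule ℝ X)
    (δ : Submodule ℝ (Module.End ℝ X)) : ℕ → Submodule ℝ (Module.End ℝ X)
  | 0 => δ
  | 1 => ⊥
  | n + 2 => csp σ ⊓ homDeg G n ⊓ bracketInto δ (flagProlong σ G δ n)

/-- The universal algebraic prolongation `𝔲^F(δ)` of `δ`. -/
def uF (σ : LinearMap.BilinForm ℝ X) (G : ℤ → Submodule ℝ X)
    (δ : Submodule ℝ (Module.End ℝ X)) : Submodule ℝ (Module.End ℝ X) :=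
  ⨆ n, flagProlong σ G δ n

/-- The standard `k`-th prolongation `P^{(k)}` of a subspace `P ⊆ 𝔤𝔩(X)`: symmetric
`(k + 1)`-linear maps `t` with values in `X` such that `x ↦ t (v₁, …, v_k, x)` lies in `P` for all
`v₁, …, v_k`. -/
def stdProlong (P : Submodule ℝ (Module.End ℝ X)) (k : ℕ) :
    Submodule ℝ (MultilinearMap ℝ (fun _ : Fin (k + 1) => X) X) where
  carrier := {t | (∀ (e : Equiv.Perm (Fin (k + 1))) (v : Fin (k + 1) → X), t (v ∘ e) = t v) ∧
    ∀ v : Fin k → X, t.curryRight v ∈ P}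
  zero_mem' := ⟨fun _ _ => rfl, fun _ => P.zero_mem⟩
  add_mem' := by
    rintro s t ⟨hs, hs'⟩ ⟨ht, ht'⟩
    refine ⟨fun e v => ?_, fun v => P.add_mem (hs' v) (ht' v)⟩
    change s (v ∘ e) + t (v ∘ e) = s v + t v
    rw [hs e v, ht e v]
  smul_mem' := by
    rintro c t ⟨ht, ht'⟩
    refine ⟨fun e v => ?_, fun v => P.smul_mem c (ht' v)⟩
    change c • t (v ∘ e) = c • t v
    rw [ht e v]

end Symplectic

/-! ### Tanaka prolongation over the Heisenberg algebra

`η = η⁻¹ ⊕ η⁻²` with `η⁻¹ = X`, `η⁻² = ℝ z`, `z` central and `[v, w] = σ(v, w) z`. -/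

section Tanaka

/-- Ambient spaces of the Tanaka prolongation; the index `n` stands for the degree `n - 2`:
`η⁻²` (the number `c` stands for `c z`), then `η⁻¹ = X`, and in degree `k ≥ 0` the sum of
`Hom(η⁻¹, degree k - 1)` and `Hom(η⁻², degree k - 2)`. A homomorphism `f` on `η⁻² = ℝ z` is given
by the vector `f z`, so that an element of degree `k ≥ 0` is the pair `(f|_X, f z)`. -/
noncomputable def Ambient (X : Type u) [AddCommGroup X] [Module ℝ X] : ℕ → ModuleCat.{u} ℝ
  | 0 => ModuleCat.of ℝ (ULift.{u} ℝ)
  | 1 => ModuleCat.of ℝ X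
  | n + 2 => ModuleCat.of ℝ ((X →ₗ[ℝ] Ambient X (n + 1)) × Ambient X n)

variable {X : Type u} [AddCommGroup X] [Module ℝ X]

/-- `f ↦ f|_X` for `f` of nonnegative degree. -/
noncomputable def onX (n : ℕ) : Ambient X (n + 2) →ₗ[ℝ] X →ₗ[ℝ] Ambient X (n + 1) :=
  LinearMap.fst ℝ (X →ₗ[ℝ] Ambient X (n + 1)) (Ambient X n)

/-- `f ↦ f z`, that is `[f, z]`, for `f` of nonnegative degree. -/
noncomputable def onZ (n : ℕ) : Ambient X (n + 2) →ₗ[ℝ] Ambient X n :=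
  LinearMap.snd ℝ (X →ₗ[ℝ] Ambient X (n + 1)) (Ambient X n)

/-- The bracket `[f, v]` of `f` of degree at least `-1` with `v ∈ X`: it is `σ(f, v) z` for `f ∈ X`
and `f v` for `f` of nonnegative degree. -/
noncomputable def bracketX (σ : LinearMap.BilinForm ℝ X) :
    (n : ℕ) → Ambient X (n + 1) →ₗ[ℝ] X →ₗ[ℝ] Ambient X n
  | 0 => (LinearMap.compRight ℝ (ULift.moduleEquiv (R := ℝ) (M := ℝ)).symm.toLinearMap ∘ₗ σ :
      X →ₗ[ℝ] X →ₗ[ℝ] ULift.{u} ℝ)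
  | n + 1 => onX n

/-- The derivation property `f [y₁, y₂] = [f y₁, y₂] + [y₁, f y₂]` on `η` for `f` of nonnegative
degree `n`; it has to be checked for `y₁, y₂ ∈ X` and for `y₁ ∈ X`, `y₂ = z` (for `y₁ = y₂ = z` it
is trivial). For degree `0` the second case holds for reasons of degree. -/
def derivations (σ : LinearMap.BilinForm ℝ X) (n : ℕ) : Submodule ℝ (Ambient X (n + 2)) where
  carrier := {f |
    (∀ v w : X, σ v w • onZ n f = bracketX σ n (onX n f v) w - bracketX σ n (onX n f w) v) ∧
    match n, f with
    | 0, _ => True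
    | m + 1, f => ∀ v : X, 0 = onZ m (onX (m + 1) f v) - bracketX σ m (onZ (m + 1) f) v}
  zero_mem' := by
    refine ⟨by intro v w; simp, ?_⟩
    cases n with
    | zero => trivial
    | succ m => intro v; simp
  add_mem' := by
    rintro f g ⟨hf, hf'⟩ ⟨hg, hg'⟩
    refine ⟨fun v w => ?_, ?_⟩
    · simp only [map_add, LinearMap.add_apply, smul_add, hf v w, hg v w]
      abel
    · cases n with
      | zero => trivial
      | succ m =>
        intro v
        have h1 := hf' v
        have h2 := hg' v
        simp only [map_add, LinearMap.add_apply]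
        rw [add_sub_add_comm, ← h1, ← h2, add_zero]
  smul_mem' := by
    rintro c f ⟨hf, hf'⟩
    refine ⟨fun v w => ?_, ?_⟩
    · simp only [map_smul, LinearMap.smul_apply, smul_comm (σ v w) c, hf v w, smul_sub]
    · cases n with
      | zero => trivial
      | succ m =>
        intro v
        have h1 := hf' v
        simp only [map_smul, LinearMap.smul_apply]
        rw [← smul_sub, ← h1, smul_zero]

/-- Elements of `Hom(η⁻¹, A) ⊕ Hom(η⁻², B)`. -/
def homInto (n : ℕ) (A : Submodule ℝ (Ambient X (n + 1))) (B : Submodule ℝ (Ambient X n)) :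
    Submodule ℝ (Ambient X (n + 2)) where
  carrier := {f | (∀ v : X, onX n f v ∈ A) ∧ onZ n f ∈ B}
  zero_mem' := by constructor <;> simp
  add_mem' := by
    rintro f g ⟨hf, hf'⟩ ⟨hg, hg'⟩
    refine ⟨fun v => ?_, ?_⟩
    · rw [map_add]; exact A.add_mem (hf v) (hg v)
    · rw [map_add]; exact B.add_mem hf' hg'
  smul_mem' := by
    rintro c f ⟨hf, hf'⟩
    refine ⟨fun v => ?_, ?_⟩
    · rw [map_smul]; exact A.smul_mem c (hf v)
    · rw [map_smul]; exact B.smul_mem c hf'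

/-- The spaces `𝔲ⁱ(η, 𝔤⁰)` for `i = n - 2 ≥ -2`, where `𝔤⁰ ⊆ 𝔠𝔰𝔭(X)` is viewed as a space of
derivations of `η` that preserve the grading. -/
noncomputable def tanaka (σ : LinearMap.BilinForm ℝ X) (g₀ : Submodule ℝ (Module.End ℝ X)) :
    (n : ℕ) → Submodule ℝ (Ambient X n)
  | 0 => ⊤
  | 1 => ⊤
  | 2 => derivations σ 0 ⊓ g₀.comap (onX 0)
  | n + 3 => derivations σ (n + 1) ⊓ homInto (n + 1) (tanaka σ g₀ (n + 2)) (tanaka σ g₀ (n + 1))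

/-- The `i`-th Tanaka algebraic prolongation `𝔲ⁱ(η, 𝔤⁰)` of the pair `(η, 𝔤⁰)`. -/
noncomputable def tanakaProlong (σ : LinearMap.BilinForm ℝ X)
    (g₀ : Submodule ℝ (Module.End ℝ X)) (i : ℕ) : Submodule ℝ (Ambient X (i + 2)) :=
  tanaka σ g₀ (i + 2)

/-- Iterated restriction to `X = η⁻¹`: `f` of degree `n - 1` goes to the `n`-linear map
`(v₁, …, v_n) ↦ f (v₁) (v₂) … (v_n)` with values in `X`. -/
noncomputable def restrictX :
    (n : ℕ) → Ambient X (n + 1) →ₗ[ℝ] MultilinearMap ℝ (fun _ : Fin n => X) X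
  | 0 => (MultilinearMap.constLinearEquivOfIsEmpty (R := ℝ) (S := ℝ) (M₁ := fun _ : Fin 0 => X)
      (M₂ := X)).toLinearMap
  | n + 1 =>
    (multilinearCurryLeftEquiv ℝ (fun _ : Fin (n + 1) => X) X).symm.toLinearMap ∘ₗ
      LinearMap.compRight ℝ (restrictX n) ∘ₗ onX n

end Tanaka

/-! ### Skew Young diagrams and tableaux -/

/-- The skew Young diagram of a direct sum of `r` indecomposable symbols `ℝδ_{s,l}`, with integers
`s ≥ 0` and `0 ≤ l ≤ 2s`, and of `t ≤ 1` symbols `ℝτ_m`, with `m = k + 1/2`. -/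
structure Diagram where
  r : ℕ
  s : Fin r → ℕ
  l : Fin r → ℕ
  l_le : ∀ i, l i ≤ 2 * s i
  t : ℕ
  t_le : t ≤ 1
  k : Fin t → ℕ

namespace Diagram

/-- The rows: for each `δ_{s,l}` an upper row `inl i` and a lower row `inr (inl i)`, and a row
`inr (inr j)` for `τ_m`. -/
abbrev Row (D : Diagram) : Type := Fin D.r ⊕ (Fin D.r ⊕ Fin D.t)

/-- The number of boxes of a row: `l + 1`, `l + 1` and `2m + 1`. -/
def len (D : Diagram) : D.Row → ℕ
  | .inl i => D.l i + 1
  | .inr (.inl i) => D.l i + 1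
  | .inr (.inr j) => 2 * D.k j + 2

/-- Twice the weight of the most left box of a row: `2s`, `2(l - s)` and `2m`. Columns are indexed
by the weight, which decreases by one from each box to the next box on its right. -/
def left (D : Diagram) : D.Row → ℤ
  | .inl i => 2 * D.s i
  | .inr (.inl i) => 2 * ((D.l i : ℤ) - D.s i)
  | .inr (.inr j) => 2 * D.k j + 1

/-- Boxes: the `a`-th box from the left, counted from `0`, of a row. -/
abbrev Box (D : Diagram) : Type := (ρ : D.Row) × Fin (D.len ρ)

/-- Twice the weight of a box. -/
def weight (D : Diagram) (x : D.Box) : ℤ := D.left x.1 - 2 * (x.2 : ℕ)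

/-- Twice the weight of the most right box of a row. -/
def right (D : Diagram) (ρ : D.Row) : ℤ := D.left ρ - 2 * ((D.len ρ : ℤ) - 1)

/-- There are no two rows such that the most left box of one of them is located in the same column
as, or from the right to, the most right box of the other one. -/
def Cond1 (D : Diagram) : Prop := ∀ ρ ρ' : D.Row, ρ ≠ ρ' → ¬ D.left ρ ≤ D.right ρ'

/-- The diagram does not consist of one row with two boxes. -/
def Cond2 (D : Diagram) : Prop := ¬ ∃ ρ : D.Row, (∀ ρ', ρ' = ρ) ∧ D.len ρ = 2

/-- Every row indexed by `ℤ` has at least `4` boxes. -/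
def Cond3 (D : Diagram) : Prop := ∀ ρ : D.Row, Even (D.left ρ) → 4 ≤ D.len ρ

/-- The row indexed by `½ + ℤ`, if it exists, has at least `6` boxes. -/
def Cond4 (D : Diagram) : Prop := ∀ ρ : D.Row, Odd (D.left ρ) → 6 ≤ D.len ρ

/-- The symplectic products of the vectors in the boxes: `σ(e_p, f_{-p}) = (-1)^{s-p}`, in a row of
type `τ_m` `σ(ε_p, ε_{-p}) = (-1)^{m-p}`, and zero for boxes that are not centrally symmetric in the
subdiagram of one indecomposable symbol. -/
def pairing (D : Diagram) : D.Box → D.Box → ℝ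
  | ⟨.inl i, a⟩, ⟨.inr (.inl j), c⟩ =>
      if i = j ∧ (a : ℕ) + (c : ℕ) = D.l i then (-1) ^ (a : ℕ) else 0
  | ⟨.inr (.inl i), a⟩, ⟨.inl j, c⟩ =>
      if i = j ∧ (a : ℕ) + (c : ℕ) = D.l i then -(-1) ^ (c : ℕ) else 0
  | ⟨.inr (.inr i), a⟩, ⟨.inr (.inr j), c⟩ =>
      if i = j ∧ (a : ℕ) + (c : ℕ) = 2 * D.k i + 1 then (-1) ^ (a : ℕ) else 0
  | _, _ => 0

end Diagram

section Tableau

variable {X : Type u} [AddCommGroup X] [Module ℝ X] {D : Diagram}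

/-- The right shift: each vector goes to the vector in the next box on the right, or to `0`. -/
noncomputable def shift (b : Module.Basis D.Box ℝ X) : Module.End ℝ X :=
  b.constr ℝ fun x => if h : (x.2 : ℕ) + 1 < D.len x.1 then b ⟨x.1, ⟨x.2 + 1, h⟩⟩ else 0

/-- A skew Young tableau of the symplectic flag symbol `δ` on `X`: a filling of the boxes of the
diagram by a basis of `X` that encodes the grading, the symplectic form and the symbol. -/
structure Tableau (σ : LinearMap.BilinForm ℝ X) (G : ℤ → Submodule ℝ X)
    (δ : Submodule ℝ (Module.End ℝ X)) (D : Diagram) where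
  basis : Module.Basis D.Box ℝ X
  mem_weight : ∀ x, basis x ∈ G (D.weight x)
  form : ∀ x y, σ (basis x) (basis y) = D.pairing x y
  symbol : δ = Submodule.span ℝ {shift basis}

namespace Tableau

variable {σ : LinearMap.BilinForm ℝ X} {G : ℤ → Submodule ℝ X}
  {δ : Submodule ℝ (Module.End ℝ X)}

/-! The embedding of `𝔰𝔩₂` into `𝔰𝔭(X)` for which each row spans an irreducible submodule and whose
part of degree `-1` is `δ`; it is spanned by `lower`, `neutral` and `raise`. On a row
`b₀, …, b_{n-1}` they act by `b_a ↦ b_{a+1}`, `b_a ↦ (n - 1 - 2a) b_a`, `b_a ↦ a (n - a) b_{a-1}`. -/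

noncomputable def lower (T : Tableau σ G δ D) : Module.End ℝ X := shift T.basis

noncomputable def neutral (T : Tableau σ G δ D) : Module.End ℝ X :=
  T.basis.constr ℝ fun x => ((D.len x.1 : ℝ) - 1 - 2 * ((x.2 : ℕ) : ℝ)) • T.basis x

noncomputable def raise (T : Tableau σ G δ D) : Module.End ℝ X :=
  T.basis.constr ℝ fun x => (((x.2 : ℕ) : ℝ) * ((D.len x.1 : ℝ) - ((x.2 : ℕ) : ℝ))) •
    T.basis ⟨x.1, ⟨(x.2 : ℕ) - 1, lt_of_le_of_lt (Nat.sub_le _ _) x.2.isLt⟩⟩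

/-- `𝔩(X)`: the maximal `𝔰𝔩₂`-submodule of `𝔰𝔭(X)` concentrated in nonnegative degrees (a sum of
such submodules is such a submodule). -/
noncomputable def lX (T : Tableau σ G δ D) : Submodule ℝ (Module.End ℝ X) :=
  sSup {S | S ≤ sp σ ⊓ nonnegDeg G ∧
    ∀ A ∈ S, T.lower * A - A * T.lower ∈ S ∧ T.neutral * A - A * T.neutral ∈ S ∧
      T.raise * A - A * T.raise ∈ S}

/-- The projection of `X` onto the span of the row `ρ` along the spans of the other rows. -/
noncomputable def rowProj (T : Tableau σ G δ D) (ρ : D.Row) : Module.End ℝ X :=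
  T.basis.constr ℝ fun x => if x.1 = ρ then T.basis x else 0

/-- The projection `π₂` of `𝔤𝔩(X)` onto `⨁_{ρ ≠ ρ'} Hom(L_ρ, L_ρ')` along `⨁_ρ 𝔤𝔩(L_ρ)`, where
`L_ρ` is the span of the row `ρ`. -/
noncomputable def offDiag (T : Tableau σ G δ D) : Module.End ℝ X →ₗ[ℝ] Module.End ℝ X :=
  LinearMap.id - ∑ ρ : D.Row,
    LinearMap.mulLeft ℝ (T.rowProj ρ) ∘ₗ LinearMap.mulRight ℝ (T.rowProj ρ)

/-- `𝔭 = π₂(𝔩(X))`. -/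
noncomputable def p (T : Tableau σ G δ D) : Submodule ℝ (Module.End ℝ X) := T.lX.map T.offDiag

end Tableau

end Tableau

end JacobiSymbol

/-! Write `F`, `H`, `E` for `lower`, `neutral`, `raise`. Two facts describe `𝔩(X)`. It is already
the largest nonnegatively graded subspace of `𝔰𝔭(X)` stable under `ad F` alone (`lX_eq_lowerCore`),
so membership is tested by iterating `ad F`. Its elements have scalar diagonal blocks (`coef_diag`),
because a nonnegatively graded `𝔰𝔩₂`-submodule of `𝔤𝔩(L_ρ)` is trivial; subtracting these scalars
gives `𝔭`, which stays inside `𝔩(X)`. Moreover `𝔲^F(δ)` contains `𝔩(X)` and is contained in the span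
of `F`, `H`, `E`, `1` plus `𝔩(X)` (`lowerCore_le_uF`, `uF_decomposition`).

The core is degree one (`firstProlong_le`). An element is a map `g : X → 𝔲^F(δ)` and a vector `z`
with `g v w - g w v = σ(v, w) z`, where `g v` has conformal factor `σ(z, v)`. Read inside one row,
this is the prolongation problem of `𝔤𝔩₂` on an irreducible module, which has no solutions for rows
this long (`row_coefs_eq_zero`, `symplectic_row_coefs_eq_zero`). So on a row `ρ` the map `g` takes
values `d • 1 + P` with `P ∈ 𝔩(X)`, and these vanish on the diagonal block of `ρ`.

Now let `w` be the last vector of another row `ρ'`. Up to a correction by `z`, the part in row `ρ'`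
of `g w` on row `ρ` lies along `w`, with the scalars of `g v` on row `ρ'` as coefficients. Applying
`(ad F)ᵐ` moves the `m`-th coefficient to the first vector of `ρ`. By the first condition `w` has
lower degree than that vector, so nonnegativity of `(ad F)ᵐ P` kills the entry. For dual rows this
forces `z = 0`; for the others it removes the remaining scalars. Hence `g` takes values in `𝔭`.

In higher degrees `f z` brackets to zero with `X` by induction, hence vanishes, and the derivation
property becomes symmetry. Conversely `𝔭 ⊆ 𝔰𝔭(X)`, so elements of `𝔭^{(i)}` extend by zero on `η⁻²`.
-/

namespace JacobiSymbol

attribute [local instance] LieRing.ofAssociativeRing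

/-! ### Combinatorics of rows and of the pairing between dual rows -/

namespace Diagram

variable (D : Diagram)

/-- The row that is dual to a given row with respect to the symplectic form. -/
def star : D.Row → D.Row
  | .inl i => .inr (.inl i)
  | .inr (.inl i) => .inl i
  | .inr (.inr j) => .inr (.inr j)

lemma star_star (ρ : D.Row) : D.star (D.star ρ) = ρ := by
  rcases ρ with i | i | j <;> rfl

lemma len_star (ρ : D.Row) : D.len (D.star ρ) = D.len ρ := by
  rcases ρ with i | i | j <;> rfl

lemma len_pos (ρ : D.Row) : 0 < D.len ρ := by
  rcases ρ with i | i | j <;> simp [len]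

lemma pairing_eq_zero {x y : D.Box} (h : y.1 = D.star x.1 → (x.2 : ℕ) + y.2 + 1 ≠ D.len x.1) :
    D.pairing x y = 0 := by
  obtain ⟨i | i | i, a, ha⟩ := x <;> obtain ⟨j | j | j, c, hc⟩ := y <;>
    simp only [pairing, star, len] at * <;> split_ifs with h' <;> try rfl
  all_goals
    obtain ⟨rfl, h'⟩ := h'
    exact absurd (by omega) (h rfl)

lemma pairing_ne_zero {x y : D.Box} (h : y.1 = D.star x.1) (h' : (x.2 : ℕ) + y.2 + 1 = D.len x.1) :
    D.pairing x y ≠ 0 := by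
  obtain ⟨i | i | i, a, ha⟩ := x <;> obtain ⟨ρ, c, hc⟩ := y <;> simp only at h <;> subst h <;>
    simp only [pairing, star, len] at * <;>
    rw [if_pos ⟨by trivial, by omega⟩] <;> simp

lemma four_le_len (h3 : D.Cond3) (h4 : D.Cond4) (ρ : D.Row) : 4 ≤ D.len ρ := by
  rcases Int.even_or_odd (D.left ρ) with h | h
  · exact h3 ρ h
  · exact (h4 ρ h).trans' (by norm_num)

lemma six_le_len (h4 : D.Cond4) (ρ : D.Row) (h : D.star ρ = ρ) : 6 ≤ D.len ρ := by
  rcases ρ with i | i | j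
  · simp [star] at h
  · simp [star] at h
  · exact h4 _ ⟨D.k j, by simp [left]⟩

lemma even_len_of_star_eq (ρ : D.Row) (h : D.star ρ = ρ) : Even (D.len ρ) := by
  rcases ρ with i | i | j
  · simp [star] at h
  · simp [star] at h
  · exact ⟨D.k j + 1, by simp [len]; ring⟩

end Diagram

/-! ### Vectors, coordinates and the operators of `𝔰𝔩₂` on rows -/

namespace Tableau

variable {X : Type u} [AddCommGroup X] [Module ℝ X] {D : Diagram}
  {σ : LinearMap.BilinForm ℝ X} {G : ℤ → Submodule ℝ X} {δ : Submodule ℝ (Module.End ℝ X)}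
  (T : Tableau σ G δ D)

/-- The vector in the `a`-th box of the row `ρ`, and zero if there is no such box. -/
noncomputable def vec (ρ : D.Row) (a : ℕ) : X :=
  if h : a < D.len ρ then T.basis ⟨ρ, a, h⟩ else 0

/-- The coordinate that belongs to the `a`-th box of the row `ρ`, and zero if there is no such
box. -/
noncomputable def coef (ρ : D.Row) (a : ℕ) : X →ₗ[ℝ] ℝ :=
  if h : a < D.len ρ then T.basis.coord ⟨ρ, a, h⟩ else 0

lemma vec_of_lt {ρ : D.Row} {a : ℕ} (h : a < D.len ρ) : T.vec ρ a = T.basis ⟨ρ, a, h⟩ := dif_pos h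

lemma vec_of_le {ρ : D.Row} {a : ℕ} (h : D.len ρ ≤ a) : T.vec ρ a = 0 := dif_neg h.not_gt

lemma coef_of_lt {ρ : D.Row} {a : ℕ} (h : a < D.len ρ) :
    T.coef ρ a = T.basis.coord ⟨ρ, a, h⟩ := dif_pos h

lemma basis_eq_vec (x : D.Box) : T.basis x = T.vec x.1 x.2 := (T.vec_of_lt x.2.2).symm

lemma coef_vec {ρ : D.Row} {a : ℕ} (h : a < D.len ρ) (k : ℕ) :
    T.coef ρ k (T.vec ρ a) = if k = a then 1 else 0 := by
  rw [vec_of_lt T h]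
  by_cases hk : k < D.len ρ
  · rw [coef_of_lt T hk, Module.Basis.coord_apply, Module.Basis.repr_self, Finsupp.single_apply]
    simp [Fin.ext_iff, eq_comm]
  · rw [coef, dif_neg hk, if_neg (by omega)]; rfl

lemma coef_vec_of_ne {ρ ρ' : D.Row} (h : ρ ≠ ρ') (k a : ℕ) : T.coef ρ k (T.vec ρ' a) = 0 := by
  by_cases ha : a < D.len ρ'
  · by_cases hk : k < D.len ρ
    · rw [vec_of_lt T ha, coef_of_lt T hk, Module.Basis.coord_apply, Module.Basis.repr_self,
        Finsupp.single_apply, if_neg]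
      intro e
      exact h (congrArg Sigma.fst e).symm
    · rw [coef, dif_neg hk]; rfl
  · rw [vec_of_le T (not_lt.1 ha), map_zero]

lemma map_ext {V : Type*} [AddCommMonoid V] [Module ℝ V] {A B : X →ₗ[ℝ] V}
    (h : ∀ ρ, ∀ a < D.len ρ, A (T.vec ρ a) = B (T.vec ρ a)) : A = B :=
  T.basis.ext fun x => by rw [T.basis_eq_vec]; exact h _ _ x.2.2

lemma ext_coef {x y : X} (h : ∀ ρ, ∀ k < D.len ρ, T.coef ρ k x = T.coef ρ k y) : x = y := by
  refine T.basis.ext_elem fun b => ?_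
  have := h b.1 b.2 b.2.2
  rwa [coef_of_lt T b.2.2] at this

lemma lower_vec (ρ : D.Row) (a : ℕ) : T.lower (T.vec ρ a) = T.vec ρ (a + 1) := by
  by_cases h : a < D.len ρ
  · rw [vec_of_lt T h, lower, shift, Module.Basis.constr_basis]; rfl
  · rw [vec_of_le T (by omega), vec_of_le T (by omega), map_zero]

lemma neutral_vec (ρ : D.Row) (a : ℕ) :
    T.neutral (T.vec ρ a) = ((D.len ρ : ℝ) - 1 - 2 * a) • T.vec ρ a := by
  by_cases h : a < D.len ρ
  · rw [vec_of_lt T h, neutral, Module.Basis.constr_basis]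
  · rw [vec_of_le T (by omega), map_zero, smul_zero]

lemma raise_vec_zero (ρ : D.Row) : T.raise (T.vec ρ 0) = 0 := by
  rw [vec_of_lt T (D.len_pos ρ), raise, Module.Basis.constr_basis]; simp

lemma raise_vec_succ (ρ : D.Row) (a : ℕ) :
    T.raise (T.vec ρ (a + 1)) = (((a : ℝ) + 1) * ((D.len ρ : ℝ) - (a + 1))) • T.vec ρ a := by
  rcases lt_trichotomy (a + 1) (D.len ρ) with h | h | h
  · rw [vec_of_lt T h, vec_of_lt T (by omega : a < D.len ρ), raise, Module.Basis.constr_basis]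
    simp
  · rw [vec_of_le T (by omega), ← h]; simp
  · rw [vec_of_le T (by omega), vec_of_le T (by omega)]; simp

lemma coef_lower_zero (ρ : D.Row) (x : X) : T.coef ρ 0 (T.lower x) = 0 := by
  suffices h : T.coef ρ 0 ∘ₗ T.lower = 0 from LinearMap.congr_fun h x
  refine T.map_ext fun ρ' a ha => ?_
  rw [LinearMap.comp_apply, lower_vec, LinearMap.zero_apply]
  by_cases h : ρ = ρ'
  · subst h
    by_cases h : a + 1 < D.len ρ
    · rw [coef_vec T h, if_neg (by omega)]
    · rw [vec_of_le T (by omega), map_zero]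
  · exact T.coef_vec_of_ne h _ _

lemma coef_lower_succ (ρ : D.Row) {k : ℕ} (hk : k + 1 < D.len ρ) (x : X) :
    T.coef ρ (k + 1) (T.lower x) = T.coef ρ k x := by
  suffices h : T.coef ρ (k + 1) ∘ₗ T.lower = T.coef ρ k from LinearMap.congr_fun h x
  refine T.map_ext fun ρ' a ha => ?_
  rw [LinearMap.comp_apply, lower_vec]
  by_cases h : ρ = ρ'
  · subst h
    rw [coef_vec T ha]
    by_cases h : a + 1 < D.len ρ
    · rw [coef_vec T h]; simp
    · rw [vec_of_le T (by omega), map_zero, if_neg (by omega)]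
  · rw [T.coef_vec_of_ne h, T.coef_vec_of_ne h]

/-! ### The symplectic form in coordinates -/

lemma form_vec_eq_zero {ρ ρ' : D.Row} {a c : ℕ} (h : ρ' = D.star ρ → a + c + 1 ≠ D.len ρ) :
    σ (T.vec ρ a) (T.vec ρ' c) = 0 := by
  by_cases ha : a < D.len ρ
  · by_cases hc : c < D.len ρ'
    · rw [vec_of_lt T ha, vec_of_lt T hc, T.form]
      exact D.pairing_eq_zero h
    · rw [vec_of_le T (not_lt.1 hc), map_zero]
  · rw [vec_of_le T (not_lt.1 ha), map_zero, LinearMap.zero_apply]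

lemma form_vec_ne_zero {ρ : D.Row} {a c : ℕ} (h : a + c + 1 = D.len ρ) :
    σ (T.vec ρ a) (T.vec (D.star ρ) c) ≠ 0 := by
  have hc : c < D.len (D.star ρ) := by rw [D.len_star]; omega
  rw [vec_of_lt T (by omega : a < D.len ρ), vec_of_lt T hc, T.form]
  exact D.pairing_ne_zero rfl h

lemma form_vec_left {ρ : D.Row} {a c : ℕ} (h : a + c + 1 = D.len ρ) (y : X) :
    σ (T.vec ρ a) y = σ (T.vec ρ a) (T.vec (D.star ρ) c) * T.coef (D.star ρ) c y := by
  suffices e : σ (T.vec ρ a) = σ (T.vec ρ a) (T.vec (D.star ρ) c) • T.coef (D.star ρ) c by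
    conv_lhs => rw [e]
    rfl
  refine T.map_ext fun ρ' k hk => ?_
  rw [LinearMap.smul_apply, smul_eq_mul]
  by_cases hρ : D.star ρ = ρ'
  · subst hρ
    rw [coef_vec T hk]
    by_cases hc : c = k
    · simp [hc]
    · rw [if_neg hc, mul_zero]
      exact T.form_vec_eq_zero fun _ => by omega
  · rw [coef_vec_of_ne T hρ, mul_zero]
    exact T.form_vec_eq_zero fun e => absurd e.symm hρ

lemma form_vec_right {ρ : D.Row} {a c : ℕ} (h : a + c + 1 = D.len ρ) (y : X) :
    σ y (T.vec (D.star ρ) c) = T.coef ρ a y * σ (T.vec ρ a) (T.vec (D.star ρ) c) := by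
  suffices e : LinearMap.flip σ (T.vec (D.star ρ) c) =
      σ (T.vec ρ a) (T.vec (D.star ρ) c) • T.coef ρ a by
    have := LinearMap.congr_fun e y
    simpa [mul_comm] using this
  refine T.map_ext fun ρ' k hk => ?_
  rw [LinearMap.smul_apply, smul_eq_mul, LinearMap.flip_apply]
  by_cases hρ : ρ = ρ'
  · subst hρ
    rw [coef_vec T hk]
    by_cases hc : a = k
    · simp [hc]
    · rw [if_neg hc, mul_zero]
      exact T.form_vec_eq_zero fun _ => by omega
  · rw [coef_vec_of_ne T hρ, mul_zero]
    refine T.form_vec_eq_zero fun e => absurd ?_ hρ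
    rw [← D.star_star ρ, e, D.star_star]

lemma sp_iff {A : Module.End ℝ X} : A ∈ sp σ ↔ ∀ ρ, ∀ a < D.len ρ, ∀ ρ', ∀ c < D.len ρ',
    σ (A (T.vec ρ a)) (T.vec ρ' c) + σ (T.vec ρ a) (A (T.vec ρ' c)) = 0 := by
  refine ⟨fun h ρ a _ ρ' c _ => h _ _, fun h x y => ?_⟩
  suffices e : σ ∘ₗ A + (σ.compl₂ A) = 0 from LinearMap.congr_fun (LinearMap.congr_fun e x) y
  exact T.map_ext fun ρ a ha => T.map_ext fun ρ' c hc => h ρ a ha ρ' c hc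

/-! ### The relations of `𝔰𝔩₂` -/

lemma raise_lie_lower : ⁅T.raise, T.lower⁆ = T.neutral := by
  refine T.map_ext fun ρ a _ => ?_
  rw [Ring.lie_def, LinearMap.sub_apply, Module.End.mul_apply, Module.End.mul_apply, lower_vec,
    raise_vec_succ, neutral_vec]
  cases a with
  | zero => rw [raise_vec_zero, map_zero]; simp
  | succ a =>
    rw [raise_vec_succ, map_smul, lower_vec, ← sub_smul]
    congr 1; push_cast; ring

lemma neutral_lie_lower : ⁅T.neutral, T.lower⁆ = (-2 : ℝ) • T.lower := by
  refine T.map_ext fun ρ a _ => ?_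
  rw [Ring.lie_def, LinearMap.sub_apply, Module.End.mul_apply, Module.End.mul_apply, neutral_vec,
    map_smul, LinearMap.smul_apply, lower_vec, neutral_vec, ← sub_smul]
  congr 1; push_cast; ring

end Tableau

/-! ### Degrees of products and brackets -/

section Degrees

variable {X : Type u} [AddCommGroup X] [Module ℝ X] {σ : LinearMap.BilinForm ℝ X}
  {G : ℤ → Submodule ℝ X}

lemma lie_mem_sp {A B : Module.End ℝ X} (hA : A ∈ sp σ) (hB : B ∈ sp σ) : ⁅A, B⁆ ∈ sp σ := by
  intro x y
  have h1 := hA (B x) y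
  have h2 := hB (A x) y
  have h3 := hA x (B y)
  have h4 := hB x (A y)
  simp only [Ring.lie_def, LinearMap.sub_apply, Module.End.mul_apply, map_sub]
  linarith

lemma mul_mem_homDeg {A B : Module.End ℝ X} {k l : ℤ} (hA : A ∈ homDeg G k)
    (hB : B ∈ homDeg G l) : A * B ∈ homDeg G (k + l) := by
  intro d x hx
  have := hA _ _ (hB d x hx)
  rwa [add_assoc, add_comm l k] at this

lemma one_mem_homDeg : (1 : Module.End ℝ X) ∈ homDeg G 0 := by
  intro d x hx
  simpa using hx

lemma lie_mem_homDeg {A B : Module.End ℝ X} {k l : ℤ} (hA : A ∈ homDeg G k)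
    (hB : B ∈ homDeg G l) : ⁅A, B⁆ ∈ homDeg G (k + l) :=
  Submodule.sub_mem _ (mul_mem_homDeg hA hB) (add_comm l k ▸ mul_mem_homDeg hB hA)

lemma homDeg_le_nonnegDeg (k : ℕ) : homDeg G k ≤ nonnegDeg G := le_iSup (fun k : ℕ => homDeg G k) k

lemma mul_mem_nonnegDeg {A B : Module.End ℝ X} (hA : A ∈ nonnegDeg G) (hB : B ∈ nonnegDeg G) :
    A * B ∈ nonnegDeg G := by
  refine Submodule.iSup_induction (fun k : ℕ => homDeg G k) (motive := fun A => A * B ∈ nonnegDeg G)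
    hA (fun k A hA => ?_) (by simp) (fun A A' h h' => by rw [add_mul]; exact add_mem h h')
  refine Submodule.iSup_induction (fun k : ℕ => homDeg G k) (motive := fun B => A * B ∈ nonnegDeg G)
    hB (fun l B hB => ?_) (by simp) (fun B B' h h' => by rw [mul_add]; exact add_mem h h')
  have h := mul_mem_homDeg hA hB
  rw [← Nat.cast_add] at h
  exact homDeg_le_nonnegDeg _ h

lemma lie_mem_nonnegDeg {A B : Module.End ℝ X} (hA : A ∈ nonnegDeg G) (hB : B ∈ nonnegDeg G) :
    ⁅A, B⁆ ∈ nonnegDeg G :=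
  Submodule.sub_mem _ (mul_mem_nonnegDeg hA hB) (mul_mem_nonnegDeg hB hA)

end Degrees

/-! ### Homogeneous endomorphisms in coordinates and the grading operator -/

namespace Tableau

variable {X : Type u} [AddCommGroup X] [Module ℝ X] {D : Diagram}
  {σ : LinearMap.BilinForm ℝ X} {G : ℤ → Submodule ℝ X} {δ : Submodule ℝ (Module.End ℝ X)}
  (T : Tableau σ G δ D)

lemma vec_mem (ρ : D.Row) (a : ℕ) : T.vec ρ a ∈ G (D.left ρ - 2 * a) := by
  by_cases h : a < D.len ρ
  · rw [vec_of_lt T h]; exact T.mem_weight ⟨ρ, a, h⟩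
  · rw [vec_of_le T (not_lt.1 h)]; exact zero_mem _

include T in
lemma finite : FiniteDimensional ℝ X := Module.Finite.of_basis T.basis

include T in
lemma nonempty_row [Nontrivial X] : Nonempty D.Row := by
  obtain ⟨x⟩ := T.basis.index_nonempty
  exact ⟨x.1⟩

/-- A tableau only places basis vectors in the components `G d`. Independence of these components
shows that the boxes of weight `d` also span `G d`. -/
lemma coord_eq_zero (hG : DirectSum.IsInternal G) {d : ℤ} {x : X} (hx : x ∈ G d) (y : D.Box)
    (hy : D.weight y ≠ d) : T.basis.repr x y = 0 := by
  classical
  let s : Finset D.Box := Finset.univ.filter fun y => D.weight y = d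
  have hsum := T.basis.sum_repr x
  rw [← Finset.sum_add_sum_compl s] at hsum
  have h1 : ∑ y ∈ s, T.basis.repr x y • T.basis y ∈ G d := by
    refine Submodule.sum_mem _ fun y hy => Submodule.smul_mem _ _ ?_
    have := (Finset.mem_filter.1 hy).2
    exact this ▸ T.mem_weight y
  have h2 : ∑ y ∈ sᶜ, T.basis.repr x y • T.basis y ∈ ⨆ j, ⨆ _ : j ≠ d, G j := by
    refine Submodule.sum_mem _ fun y hy => Submodule.smul_mem _ _ ?_
    have : D.weight y ≠ d := by simpa [s] using hy
    exact Submodule.mem_iSup_of_mem _ (Submodule.mem_iSup_of_mem this (T.mem_weight y))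
  have h3 : ∑ y ∈ sᶜ, T.basis.repr x y • T.basis y ∈ G d := by
    rw [← eq_sub_iff_add_eq'] at hsum
    rw [hsum]
    exact sub_mem hx h1
  have h4 := Submodule.disjoint_def.1 (hG.submodule_iSupIndep d) _ h3 h2
  exact linearIndependent_iff'.1 T.basis.linearIndependent _ _ h4 y (by simpa [s] using hy)

lemma coef_eq_zero (hG : DirectSum.IsInternal G) {d : ℤ} {x : X} (hx : x ∈ G d) (ρ : D.Row) (a : ℕ)
    (h : D.left ρ - 2 * a ≠ d) : T.coef ρ a x = 0 := by
  by_cases ha : a < D.len ρ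
  · rw [coef_of_lt T ha]; exact T.coord_eq_zero hG hx _ h
  · rw [coef, dif_neg ha]; rfl

lemma mem_homDeg (hG : DirectSum.IsInternal G) {A : Module.End ℝ X} {k : ℤ}
    (h : ∀ ρ (a : ℕ), A (T.vec ρ a) ∈ G (D.left ρ - 2 * a + k)) : A ∈ homDeg G k := by
  intro d x hx
  rw [← T.basis.sum_repr x, map_sum]
  refine Submodule.sum_mem _ fun y _ => ?_
  rw [map_smul]
  by_cases hy : D.weight y = d
  · refine Submodule.smul_mem _ _ ?_
    rw [T.basis_eq_vec, ← hy]
    exact h _ _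
  · rw [T.coord_eq_zero hG hx y hy, zero_smul]
    exact zero_mem _

lemma coef_eq_zero_of_homDeg (hG : DirectSum.IsInternal G) {A : Module.End ℝ X} {k : ℤ}
    (hA : A ∈ homDeg G k) {ρ ρ' : D.Row} {a c : ℕ}
    (h : D.left ρ' - 2 * c ≠ D.left ρ - 2 * a + k) : T.coef ρ' c (A (T.vec ρ a)) = 0 :=
  T.coef_eq_zero hG (hA _ _ (T.vec_mem ρ a)) _ _ h

lemma coef_eq_zero_of_nonnegDeg (hG : DirectSum.IsInternal G) {A : Module.End ℝ X}
    (hA : A ∈ nonnegDeg G) {ρ ρ' : D.Row} {a c : ℕ}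
    (h : D.left ρ' - 2 * c < D.left ρ - 2 * a) : T.coef ρ' c (A (T.vec ρ a)) = 0 := by
  refine Submodule.iSup_induction (fun k : ℕ => homDeg G k)
    (motive := fun A => T.coef ρ' c (A (T.vec ρ a)) = 0)
    hA (fun k A hA => T.coef_eq_zero_of_homDeg hG hA (by omega)) (by simp) (fun A B h h' => ?_)
  rw [LinearMap.add_apply, map_add, h, h', add_zero]

include T in
lemma eq_zero_of_nonnegDeg (hG : DirectSum.IsInternal G) {A : Module.End ℝ X} {k : ℤ}
    (hA : A ∈ nonnegDeg G) (hk : A ∈ homDeg G k) (h : k < 0) : A = 0 := by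
  refine T.map_ext fun ρ (a : ℕ) _ => T.ext_coef fun ρ' (c : ℕ) _ => ?_
  rw [LinearMap.zero_apply, map_zero]
  by_cases h' : D.left ρ' - 2 * c = D.left ρ - 2 * a + k
  · exact T.coef_eq_zero_of_nonnegDeg hG hA (by omega)
  · exact T.coef_eq_zero_of_homDeg hG hk h'

/-- The grading operator: multiplication by the doubled weight. -/
noncomputable def grading : Module.End ℝ X :=
  T.basis.constr ℝ fun x => (D.weight x : ℝ) • T.basis x

lemma grading_vec (ρ : D.Row) (a : ℕ) :
    T.grading (T.vec ρ a) = ((D.left ρ : ℝ) - 2 * a) • T.vec ρ a := by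
  by_cases h : a < D.len ρ
  · rw [vec_of_lt T h, grading, Module.Basis.constr_basis]
    simp [Diagram.weight]
  · rw [vec_of_le T (by omega), map_zero, smul_zero]

lemma grading_lie_lower : ⁅T.grading, T.lower⁆ = (-2 : ℝ) • T.lower := by
  refine T.map_ext fun ρ a _ => ?_
  rw [Ring.lie_def, LinearMap.sub_apply, Module.End.mul_apply, Module.End.mul_apply, grading_vec,
    map_smul, LinearMap.smul_apply, lower_vec, grading_vec, ← sub_smul]
  congr 1; push_cast; ring

lemma mem_homDeg_of_diagonal (hG : DirectSum.IsInternal G) {A : Module.End ℝ X}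
    (h : ∀ ρ a, ∃ c : ℝ, A (T.vec ρ a) = c • T.vec ρ a) : A ∈ homDeg G 0 := by
  refine T.mem_homDeg hG fun ρ (a : ℕ) => ?_
  obtain ⟨c, hc⟩ := h ρ a
  rw [hc, add_zero]
  exact Submodule.smul_mem _ _ (T.vec_mem ρ a)

lemma grading_mem_homDeg (hG : DirectSum.IsInternal G) : T.grading ∈ homDeg G 0 :=
  T.mem_homDeg_of_diagonal hG fun ρ a => ⟨_, T.grading_vec ρ a⟩

lemma neutral_mem_homDeg (hG : DirectSum.IsInternal G) : T.neutral ∈ homDeg G 0 :=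
  T.mem_homDeg_of_diagonal hG fun ρ a => ⟨_, T.neutral_vec ρ a⟩

lemma raise_mem_homDeg (hG : DirectSum.IsInternal G) : T.raise ∈ homDeg G 2 := by
  refine T.mem_homDeg hG fun ρ (a : ℕ) => ?_
  cases a with
  | zero => rw [raise_vec_zero]; exact zero_mem _
  | succ a =>
    rw [raise_vec_succ]
    refine Submodule.smul_mem _ _ ?_
    have := T.vec_mem ρ a
    convert this using 2
    push_cast; ring

lemma coef_grading_lie (A : Module.End ℝ X) (ρ : D.Row) (a : ℕ) (ρ' : D.Row) (c : ℕ) :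
    T.coef ρ' c (⁅T.grading, A⁆ (T.vec ρ a)) =
      (((D.left ρ' : ℝ) - 2 * c) - ((D.left ρ : ℝ) - 2 * a)) * T.coef ρ' c (A (T.vec ρ a)) := by
  have e : T.coef ρ' c ∘ₗ T.grading = ((D.left ρ' : ℝ) - 2 * c) • T.coef ρ' c := by
    refine T.map_ext fun ρ₁ a₁ h₁ => ?_
    rw [LinearMap.comp_apply, grading_vec, map_smul, LinearMap.smul_apply]
    by_cases h : ρ' = ρ₁
    · subst h
      rw [coef_vec T h₁]
      by_cases h : c = a₁
      · rw [h]
      · simp [h]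
    · simp [coef_vec_of_ne T h]
  rw [Ring.lie_def, LinearMap.sub_apply, Module.End.mul_apply, Module.End.mul_apply, grading_vec,
    map_sub, ← LinearMap.comp_apply, e, LinearMap.smul_apply, map_smul, map_smul, smul_eq_mul,
    smul_eq_mul, ← sub_mul]

/-- Degree becomes an eigenvalue of a semisimple operator, so that subspaces stable under it split
into homogeneous parts. -/
lemma mem_homDeg_iff (hG : DirectSum.IsInternal G) {A : Module.End ℝ X} {k : ℤ} :
    A ∈ homDeg G k ↔ ⁅T.grading, A⁆ = (k : ℝ) • A := by
  constructor
  · intro h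
    refine T.map_ext fun ρ (a : ℕ) _ => T.ext_coef fun ρ' (c : ℕ) _ => ?_
    rw [coef_grading_lie, LinearMap.smul_apply, map_smul, smul_eq_mul]
    by_cases h' : D.left ρ' - 2 * c = D.left ρ - 2 * a + k
    · congr 1
      have : ((D.left ρ' - 2 * c : ℤ) : ℝ) = ((D.left ρ - 2 * a + k : ℤ) : ℝ) := by rw [h']
      push_cast at this
      linarith
    · rw [T.coef_eq_zero_of_homDeg hG h h', mul_zero, mul_zero]
  · intro h
    refine T.mem_homDeg hG fun ρ (a : ℕ) => ?_
    rw [← T.basis.sum_repr (A _)]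
    refine Submodule.sum_mem _ fun y _ => ?_
    by_cases h' : D.weight y = D.left ρ - 2 * a + k
    · exact Submodule.smul_mem _ _ (h' ▸ T.mem_weight y)
    · suffices e : T.basis.repr (A (T.vec ρ a)) y = 0 by rw [e, zero_smul]; exact zero_mem _
      have h1 := T.coef_grading_lie A ρ a y.1 y.2
      rw [h, LinearMap.smul_apply, map_smul, smul_eq_mul, coef_of_lt T y.2.2] at h1
      change (k : ℝ) * T.basis.repr (A (T.vec ρ a)) y = _ * T.basis.repr (A (T.vec ρ a)) y at h1
      rw [← sub_eq_zero, ← sub_mul] at h1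
      refine (mul_eq_zero.1 h1).resolve_left fun e => h' ?_
      have : ((D.weight y : ℤ) : ℝ) = ((D.left ρ - 2 * a + k : ℤ) : ℝ) := by
        simp only [Diagram.weight]; push_cast; linarith
      exact_mod_cast this

/-! ### Elements of the symplectic algebra -/

variable (hδ : IsSymplecticFlagSymbol σ G δ)

include hδ T in
lemma left_add_eq (ρ : D.Row) {a c : ℕ} (h : a + c + 1 = D.len ρ) :
    D.left ρ - 2 * a + (D.left (D.star ρ) - 2 * c) = 0 := by
  by_contra hne
  exact T.form_vec_ne_zero h (hδ.orthogonal _ _ hne _ (T.vec_mem _ _) _ (T.vec_mem _ _))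

-- On a dual pair of basis vectors both terms of the conformal identity vanish for reasons of weight
-- when the degree is nonzero, while `σ` does not; so the conformal factor is zero.
include hδ T in
lemma mem_sp_of_homDeg {A : Module.End ℝ X} {k : ℤ} (hA : A ∈ csp σ) (hk : A ∈ homDeg G k)
    (h : k ≠ 0) : A ∈ sp σ := by
  obtain ⟨c, hc⟩ := hA
  rcases subsingleton_or_nontrivial X with hX | hX
  · intro x y
    rw [Subsingleton.elim x 0, Subsingleton.elim (A y) 0]; simp
  obtain ⟨ρ⟩ := T.nonempty_row
  have hlen := D.len_pos ρ
  have hw : 0 + (D.len ρ - 1) + 1 = D.len ρ := by omega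
  have h0 := T.left_add_eq hδ ρ hw
  have h1 := hc (T.vec ρ 0) (T.vec (D.star ρ) (D.len ρ - 1))
  rw [hδ.orthogonal _ _ _ _ (hk _ _ (T.vec_mem _ _)) _ (T.vec_mem _ _),
    hδ.orthogonal _ _ _ _ (T.vec_mem _ _) _ (hk _ _ (T.vec_mem _ _)), add_zero] at h1
  · have hc0 : c = 0 := (mul_eq_zero.1 h1.symm).resolve_right (T.form_vec_ne_zero hw)
    intro x y
    rw [hc, hc0, zero_mul]
  · omega
  · omega

include hδ in
lemma lower_mem : T.lower ∈ csp σ ⊓ homDeg G (-2) := by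
  obtain ⟨A, hA, h⟩ := hδ.line
  have : T.lower ∈ Submodule.span ℝ {A} := by
    rw [← h]
    exact T.symbol.symm.le (Submodule.mem_span_singleton_self _)
  obtain ⟨c, hc⟩ := Submodule.mem_span_singleton.1 this
  rw [← hc]
  exact Submodule.smul_mem _ _ hA

include hδ in
lemma lower_mem_sp : T.lower ∈ sp σ :=
  T.mem_sp_of_homDeg hδ (T.lower_mem hδ).1 (T.lower_mem hδ).2 (by norm_num)

lemma mem_sp_of_diagonal {A : Module.End ℝ X} (f : D.Row → ℕ → ℝ)
    (hA : ∀ ρ a, A (T.vec ρ a) = f ρ a • T.vec ρ a)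
    (hf : ∀ ρ a c, a + c + 1 = D.len ρ → f ρ a + f (D.star ρ) c = 0) : A ∈ sp σ := by
  refine T.sp_iff.2 fun ρ a _ ρ' c _ => ?_
  rw [hA, hA, map_smul, LinearMap.smul_apply, map_smul, ← add_smul]
  by_cases h : ρ' = D.star ρ ∧ a + c + 1 = D.len ρ
  · rw [h.1, hf _ _ _ h.2, zero_smul]
  · rw [T.form_vec_eq_zero fun e e' => h ⟨e, e'⟩, smul_zero]

lemma neutral_mem_sp : T.neutral ∈ sp σ := by
  refine T.mem_sp_of_diagonal _ T.neutral_vec fun ρ a c h => ?_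
  rw [D.len_star, ← h]; push_cast; ring

include hδ in
lemma grading_mem_sp : T.grading ∈ sp σ := by
  refine T.mem_sp_of_diagonal _ T.grading_vec fun ρ a c h => ?_
  exact_mod_cast T.left_add_eq hδ ρ h

-- The factor `a (n - a)` of `E` takes the same value on the two boxes that have to be compared, so
-- the identity for `E` is a multiple of the one for `F`.
include hδ in
lemma raise_mem_sp : T.raise ∈ sp σ := by
  refine T.sp_iff.2 fun ρ a ha ρ' c hc => ?_
  by_cases h : ρ' = D.star ρ ∧ a + c = D.len ρ
  · obtain ⟨rfl, h⟩ := h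
    rw [D.len_star] at hc
    obtain ⟨a, rfl⟩ : ∃ k, a = k + 1 := ⟨a - 1, by omega⟩
    obtain ⟨c, rfl⟩ : ∃ k, c = k + 1 := ⟨c - 1, by omega⟩
    have h1 := T.lower_mem_sp hδ (T.vec ρ a) (T.vec (D.star ρ) c)
    rw [lower_vec, lower_vec] at h1
    rw [raise_vec_succ, raise_vec_succ, map_smul, map_smul, LinearMap.smul_apply, D.len_star, ← h]
    simp only [smul_eq_mul]
    push_cast
    linear_combination ((a : ℝ) + 1) * (c + 1) * h1
  · have e1 : σ (T.raise (T.vec ρ a)) (T.vec ρ' c) = 0 := by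
      cases a with
      | zero => rw [raise_vec_zero, map_zero, LinearMap.zero_apply]
      | succ a =>
        rw [raise_vec_succ, map_smul, LinearMap.smul_apply, T.form_vec_eq_zero, smul_zero]
        intro e e'
        exact h ⟨e, by omega⟩
    have e2 : σ (T.vec ρ a) (T.raise (T.vec ρ' c)) = 0 := by
      cases c with
      | zero => rw [raise_vec_zero, map_zero]
      | succ c =>
        rw [raise_vec_succ, map_smul, T.form_vec_eq_zero, smul_zero]
        intro e e'
        exact h ⟨e, by omega⟩
    rw [e1, e2, add_zero]

end Tableau

/-! ### `𝔩(X)` through iterated brackets with `F` -/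

namespace Tableau

variable {X : Type u} [AddCommGroup X] [Module ℝ X] {D : Diagram}
  {σ : LinearMap.BilinForm ℝ X} {G : ℤ → Submodule ℝ X} {δ : Submodule ℝ (Module.End ℝ X)}
  (T : Tableau σ G δ D)

/-- The bracket with the lowering operator. -/
noncomputable def adLower : Module.End ℝ (Module.End ℝ X) :=
  LieAlgebra.ad ℝ (Module.End ℝ X) T.lower

lemma adLower_apply (A : Module.End ℝ X) : T.adLower A = ⁅T.lower, A⁆ := rfl

lemma adLower_vec (A : Module.End ℝ X) (ρ : D.Row) (a : ℕ) :
    T.adLower A (T.vec ρ a) = T.lower (A (T.vec ρ a)) - A (T.vec ρ (a + 1)) := by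
  rw [← T.lower_vec]; rfl

/-- The largest subspace of the nonnegative part of `𝔰𝔭(X)` that is stable under the bracket with
the lowering operator. -/
noncomputable def lowerCore : Submodule ℝ (Module.End ℝ X) :=
  sp σ ⊓ ⨅ j : ℕ, (nonnegDeg G).comap (T.adLower ^ j)

lemma mem_lowerCore {A : Module.End ℝ X} :
    A ∈ T.lowerCore ↔ A ∈ sp σ ∧ ∀ j, (T.adLower ^ j) A ∈ nonnegDeg G := by
  simp [lowerCore]

lemma lowerCore_le_sp : T.lowerCore ≤ sp σ := inf_le_left

lemma nonneg_of_mem_lowerCore {A : Module.End ℝ X} (hA : A ∈ T.lowerCore) : A ∈ nonnegDeg G :=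
  (T.mem_lowerCore.1 hA).2 0

variable (hδ : IsSymplecticFlagSymbol σ G δ)

include hδ in
lemma adLower_mem {A : Module.End ℝ X} (hA : A ∈ T.lowerCore) : T.adLower A ∈ T.lowerCore := by
  rw [mem_lowerCore] at hA ⊢
  refine ⟨lie_mem_sp (T.lower_mem_sp hδ) hA.1, fun j => ?_⟩
  have := hA.2 (j + 1)
  rwa [pow_succ] at this

lemma mem_lowerCore_of_adLower_mem {A : Module.End ℝ X} (h : A ∈ sp σ) (h' : A ∈ nonnegDeg G)
    (hA : T.adLower A ∈ T.lowerCore) : A ∈ T.lowerCore := by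
  refine T.mem_lowerCore.2 ⟨h, fun j => ?_⟩
  cases j with
  | zero => exact h'
  | succ j => rw [pow_succ]; exact (T.mem_lowerCore.1 hA).2 j

lemma adLower_lie (A B : Module.End ℝ X) :
    T.adLower ⁅A, B⁆ = ⁅T.adLower A, B⁆ + ⁅A, T.adLower B⁆ := by
  rw [adLower_apply, leibniz_lie]; rfl

-- By the Leibniz rule, stability under `ad K` follows from stability under `ad [F, K]`. Since `[F,
-- H] = 2F` and `[F, E] = -H`, stability under `F` propagates to `H` and then to `E`.
include hδ in
lemma lie_mem_lowerCore {K : Module.End ℝ X} (hK : K ∈ sp σ) (hK' : K ∈ nonnegDeg G)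
    (h : ∀ A ∈ T.lowerCore, ⁅T.adLower K, A⁆ ∈ T.lowerCore) {A : Module.End ℝ X}
    (hA : A ∈ T.lowerCore) : ⁅K, A⁆ ∈ T.lowerCore := by
  refine T.mem_lowerCore.2 ⟨lie_mem_sp hK hA.1, fun j => ?_⟩
  induction j generalizing A with
  | zero => exact lie_mem_nonnegDeg hK' (T.nonneg_of_mem_lowerCore hA)
  | succ j ih =>
    rw [pow_succ, Module.End.mul_apply, adLower_lie, map_add]
    exact add_mem ((T.mem_lowerCore.1 (h A hA)).2 j) (ih (T.adLower_mem hδ hA))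

include hδ in
lemma lower_smul_lie_mem (c : ℝ) {A : Module.End ℝ X} (hA : A ∈ T.lowerCore) :
    ⁅c • T.lower, A⁆ ∈ T.lowerCore := by
  rw [Ring.lie_def, smul_mul_assoc, mul_smul_comm, ← smul_sub]
  exact Submodule.smul_mem _ _ (T.adLower_mem hδ hA)

lemma adLower_neutral : T.adLower T.neutral = (2 : ℝ) • T.lower := by
  rw [adLower_apply, ← lie_skew, neutral_lie_lower, neg_smul, neg_neg]

lemma adLower_grading : T.adLower T.grading = (2 : ℝ) • T.lower := by
  rw [adLower_apply, ← lie_skew, grading_lie_lower, neg_smul, neg_neg]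

lemma adLower_raise : T.adLower T.raise = -T.neutral := by
  rw [adLower_apply, ← lie_skew, raise_lie_lower]

include hδ in
lemma neutral_lie_mem {A : Module.End ℝ X} (hA : A ∈ T.lowerCore) :
    ⁅T.neutral, A⁆ ∈ T.lowerCore :=
  T.lie_mem_lowerCore hδ T.neutral_mem_sp
    (homDeg_le_nonnegDeg 0 (T.neutral_mem_homDeg hδ.internal))
    (fun _ hB => T.adLower_neutral ▸ T.lower_smul_lie_mem hδ _ hB) hA

include hδ in
lemma grading_lie_mem {A : Module.End ℝ X} (hA : A ∈ T.lowerCore) :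
    ⁅T.grading, A⁆ ∈ T.lowerCore :=
  T.lie_mem_lowerCore hδ (T.grading_mem_sp hδ)
    (homDeg_le_nonnegDeg 0 (T.grading_mem_homDeg hδ.internal))
    (fun _ hB => T.adLower_grading ▸ T.lower_smul_lie_mem hδ _ hB) hA

include hδ in
lemma raise_lie_mem {A : Module.End ℝ X} (hA : A ∈ T.lowerCore) :
    ⁅T.raise, A⁆ ∈ T.lowerCore := by
  refine T.lie_mem_lowerCore hδ (T.raise_mem_sp hδ)
    (homDeg_le_nonnegDeg 2 (T.raise_mem_homDeg hδ.internal)) (fun B hB => ?_) hA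
  rw [adLower_raise, neg_lie]
  exact neg_mem (T.neutral_lie_mem hδ hB)

include hδ in
theorem lX_eq_lowerCore : T.lX = T.lowerCore := by
  refine le_antisymm (sSup_le ?_) (le_sSup ?_)
  · rintro S ⟨hS, hS'⟩ A hA
    refine T.mem_lowerCore.2 ⟨(hS hA).1, fun j => ?_⟩
    induction j generalizing A with
    | zero => exact (hS hA).2
    | succ j ih => rw [pow_succ]; exact ih (hS' A hA).1
  · exact ⟨fun A hA => ⟨hA.1, T.nonneg_of_mem_lowerCore hA⟩, fun A hA =>
      ⟨T.adLower_mem hδ hA, T.neutral_lie_mem hδ hA, T.raise_lie_mem hδ hA⟩⟩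

/-! ### Diagonal blocks -/

-- Comparing coordinates in `[F, A] v = F A v - A F v` gives the recursion of Pascal's triangle;
-- nonnegativity of `[F, A]` supplies its boundary values.
include hδ in
lemma coef_diag_eq (ρ : D.Row) {k i : ℕ} (hk : k < D.len ρ) {A : Module.End ℝ X}
    (hA : A ∈ T.lowerCore) : T.coef ρ k (A (T.vec ρ (k + i))) =
      (-1) ^ i * ((k + i).choose i) * T.coef ρ 0 ((T.adLower ^ i) A (T.vec ρ 0)) := by
  induction k generalizing i A with
  | zero =>
    rw [zero_add, Nat.choose_self]
    induction i generalizing A with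
    | zero => simp
    | succ i ih =>
      have h := congrArg (T.coef ρ 0) (T.adLower_vec A ρ i)
      rw [map_sub, coef_lower_zero, zero_sub, ih (T.adLower_mem hδ hA)] at h
      rw [pow_succ T.adLower, Module.End.mul_apply, pow_succ]
      linarith
  | succ k ih =>
    induction i generalizing A with
    | zero =>
      have h := congrArg (T.coef ρ (k + 1)) (T.adLower_vec A ρ k)
      have h0 := ih (i := 0) (by omega) hA
      rw [add_zero] at h0
      rw [map_sub, coef_lower_succ T _ hk, h0,
        T.coef_eq_zero_of_nonnegDeg hδ.internal
          (T.nonneg_of_mem_lowerCore (T.adLower_mem hδ hA)) (by push_cast; omega)] at h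
      simp only [add_zero, Nat.choose_zero_right] at h ⊢
      linarith
    | succ i ih' =>
      have h := congrArg (T.coef ρ (k + 1)) (T.adLower_vec A ρ (k + 1 + i))
      rw [map_sub, coef_lower_succ T _ hk, add_right_comm k 1 i, add_assoc k i 1,
        ih (by omega) hA, ← add_assoc, add_right_comm k i 1, ih' (T.adLower_mem hδ hA)] at h
      rw [← add_assoc (k + 1), Nat.choose_succ_succ (k + 1 + i) i]
      rw [pow_succ T.adLower, Module.End.mul_apply] at h ⊢
      push_cast [Nat.succ_eq_add_one]
      rw [pow_succ] at h ⊢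
      linarith

/-- The scalar by which the diagonal block of the row `ρ` of an element of `lowerCore` acts. -/
noncomputable def scalar (A : Module.End ℝ X) (ρ : D.Row) : ℝ := T.coef ρ 0 (A (T.vec ρ 0))

include hδ in
lemma coef_diag {A : Module.End ℝ X} (hA : A ∈ T.lowerCore) (ρ : D.Row) {k a : ℕ}
    (ha : a < D.len ρ) :
    T.coef ρ k (A (T.vec ρ a)) = if k = a then T.scalar A ρ else 0 := by
  by_cases hk : D.len ρ ≤ k
  · rw [if_neg (by omega), coef, dif_neg (by omega)]; rfl
  push Not at hk
  by_cases hka : k ≤ a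
  · obtain ⟨i, rfl⟩ := Nat.exists_eq_add_of_le hka
    rw [T.coef_diag_eq hδ ρ hk hA]
    cases i with
    | zero => simp [scalar]
    | succ i =>
      rw [if_neg (by omega)]
      -- Here `k + i` is the length of the row, so the vector lies past its end and is zero. As the
      -- binomial coefficient is not, the common factor of this whole diagonal vanishes.
      have h := T.coef_diag_eq hδ ρ (k := D.len ρ - (i + 1)) (i := i + 1) (by omega) hA
      rw [vec_of_le T (by omega), map_zero, map_zero] at h
      have h' : (-1 : ℝ) ^ (i + 1) * ((D.len ρ - (i + 1) + (i + 1)).choose (i + 1) : ℕ) ≠ 0 := by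
        refine mul_ne_zero (pow_ne_zero _ (by norm_num)) ?_
        exact_mod_cast (Nat.choose_pos (by omega)).ne'
      rw [(mul_eq_zero.1 h.symm).resolve_left h', mul_zero]
  · rw [if_neg (by omega)]
    exact T.coef_eq_zero_of_nonnegDeg hδ.internal (T.nonneg_of_mem_lowerCore hA) (by omega)

include hδ in
lemma scalar_star {A : Module.End ℝ X} (hA : A ∈ T.lowerCore) (ρ : D.Row) :
    T.scalar A (D.star ρ) = -T.scalar A ρ := by
  have hl := D.len_pos ρ
  have hw : 0 + (D.len ρ - 1) + 1 = D.len ρ := by omega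
  have h := T.lowerCore_le_sp hA (T.vec ρ 0) (T.vec (D.star ρ) (D.len ρ - 1))
  rw [T.form_vec_left hw, T.form_vec_right hw, T.coef_diag hδ hA _ hl,
    T.coef_diag hδ hA _ (by rw [D.len_star]; omega), if_pos rfl, if_pos rfl] at h
  have : (T.scalar A (D.star ρ) + T.scalar A ρ) *
      σ (T.vec ρ 0) (T.vec (D.star ρ) (D.len ρ - 1)) = 0 := by linarith
  have := (mul_eq_zero.1 this).resolve_right (T.form_vec_ne_zero hw)
  linarith

lemma rowProj_vec (ρ ρ' : D.Row) (a : ℕ) :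
    T.rowProj ρ (T.vec ρ' a) = if ρ' = ρ then T.vec ρ' a else 0 := by
  by_cases h : a < D.len ρ'
  · rw [vec_of_lt T h, rowProj, Module.Basis.constr_basis]
  · rw [vec_of_le T (by omega), map_zero, ite_self]

lemma coef_rowProj (ρ ρ' : D.Row) (k : ℕ) (x : X) :
    T.coef ρ' k (T.rowProj ρ x) = if ρ' = ρ then T.coef ρ' k x else 0 := by
  suffices e : T.coef ρ' k ∘ₗ T.rowProj ρ = if ρ' = ρ then T.coef ρ' k else 0 by
    have := LinearMap.congr_fun e x
    rw [LinearMap.comp_apply] at this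
    rw [this]; split_ifs <;> rfl
  refine T.map_ext fun ρ₁ a ha => ?_
  rw [LinearMap.comp_apply, rowProj_vec]
  by_cases h : ρ₁ = ρ <;> by_cases h' : ρ' = ρ
  · simp [h, h']
  · simp [h, h', T.coef_vec_of_ne h']
  · subst h'; simp [h, T.coef_vec_of_ne (Ne.symm h)]
  · simp [h, h']

include hδ in
lemma offDiag_vec {A : Module.End ℝ X} (hA : A ∈ T.lowerCore) (ρ : D.Row) (a : ℕ) :
    T.offDiag A (T.vec ρ a) = A (T.vec ρ a) - T.scalar A ρ • T.vec ρ a := by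
  by_cases ha : a < D.len ρ
  swap
  · rw [vec_of_le T (by omega)]; simp
  rw [offDiag, LinearMap.sub_apply, LinearMap.sub_apply, LinearMap.id_apply, LinearMap.sum_apply,
    LinearMap.sum_apply]
  congr 1
  rw [Finset.sum_eq_single ρ]
  · simp only [LinearMap.comp_apply, LinearMap.mulLeft_apply, LinearMap.mulRight_apply,
      Module.End.mul_apply, rowProj_vec, if_true]
    refine T.ext_coef fun ρ' k _ => ?_
    rw [coef_rowProj, map_smul, smul_eq_mul]
    by_cases h : ρ' = ρ
    · subst h
      rw [if_pos rfl, T.coef_diag hδ hA _ ha, coef_vec T ha]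
      simp
    · rw [if_neg h, T.coef_vec_of_ne h, mul_zero]
  · intro ρ' _ h
    simp [rowProj_vec, h.symm]
  · simp

include hδ in
lemma mem_p_of_scalar_eq_zero {A : Module.End ℝ X} (hA : A ∈ T.lowerCore)
    (h : ∀ ρ, T.scalar A ρ = 0) : A ∈ T.p := by
  refine ⟨A, by rwa [SetLike.mem_coe, T.lX_eq_lowerCore hδ], ?_⟩
  refine T.map_ext fun ρ a _ => ?_
  rw [T.offDiag_vec hδ hA, h, zero_smul, sub_zero]

-- The diagonal part subtracted from an element of `𝔩(X)` is itself in `𝔩(X)`: it commutes with `F`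
-- and has degree zero, and its scalars on dual rows are opposite.
include hδ in
lemma p_le_lowerCore : T.p ≤ T.lowerCore := by
  rintro _ ⟨A, hA, rfl⟩
  rw [SetLike.mem_coe, T.lX_eq_lowerCore hδ] at hA
  have e : T.offDiag A = A - (A - T.offDiag A) := by abel
  have hM : ∀ ρ a, (A - T.offDiag A) (T.vec ρ a) = T.scalar A ρ • T.vec ρ a := by
    intro ρ a
    rw [LinearMap.sub_apply, T.offDiag_vec hδ hA]; abel
  rw [e]
  refine sub_mem hA (T.mem_lowerCore_of_adLower_mem ?_ ?_ ?_)
  · refine T.mem_sp_of_diagonal (fun ρ _ => T.scalar A ρ) hM fun ρ a c _ => ?_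
    rw [T.scalar_star hδ hA]; ring
  · exact homDeg_le_nonnegDeg 0 (T.mem_homDeg_of_diagonal hδ.internal fun ρ a => ⟨_, hM ρ a⟩)
  · suffices h : T.adLower (A - T.offDiag A) = 0 by rw [h]; exact zero_mem _
    refine T.map_ext fun ρ a _ => ?_
    rw [adLower_vec, hM, hM, map_smul, lower_vec, sub_self, LinearMap.zero_apply]

end Tableau

/-! ### Comparison of `𝔲^F(δ)` with `𝔩(X)` -/

namespace Tableau

variable {X : Type u} [AddCommGroup X] [Module ℝ X] {D : Diagram}
  {σ : LinearMap.BilinForm ℝ X} {G : ℤ → Submodule ℝ X} {δ : Submodule ℝ (Module.End ℝ X)}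
  (T : Tableau σ G δ D)

lemma mem_symbol_iff {A : Module.End ℝ X} : A ∈ δ ↔ ∃ c : ℝ, c • T.lower = A := by
  conv_lhs => rw [T.symbol]
  exact Submodule.mem_span_singleton

lemma mem_bracketInto {A : Module.End ℝ X} {S : Submodule ℝ (Module.End ℝ X)} :
    A ∈ bracketInto δ S ↔ T.adLower A ∈ S := by
  constructor
  · intro h
    have := h T.lower (T.mem_symbol_iff.2 ⟨1, one_smul _ _⟩)
    rw [← neg_mem_iff]
    rwa [adLower_apply, Ring.lie_def, neg_sub]
  · intro h x hx
    obtain ⟨c, rfl⟩ := T.mem_symbol_iff.1 hx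
    have := S.smul_mem (-c) h
    rw [adLower_apply, Ring.lie_def, neg_smul, ← smul_neg, neg_sub] at this
    rwa [mul_smul_comm, smul_mul_assoc, ← smul_sub]

lemma sp_le_csp : sp σ ≤ csp σ := fun A hA => ⟨0, fun x y => by rw [hA, zero_mul]⟩

variable (hδ : IsSymplecticFlagSymbol σ G δ)

include hδ in
lemma adLower_mem_homDeg {A : Module.End ℝ X} {k : ℤ} (hA : A ∈ homDeg G k) :
    T.adLower A ∈ homDeg G (k - 2) := by
  have := lie_mem_homDeg (T.lower_mem hδ).2 hA
  rwa [neg_add_eq_sub] at this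

include hδ in
lemma mem_flagProlong (n : ℕ) {A : Module.End ℝ X} (hA : A ∈ T.lowerCore)
    (hn : A ∈ homDeg G n) : A ∈ flagProlong σ G δ (n + 2) := by
  induction n using Nat.strong_induction_on generalizing A with
  | _ n ih =>
    refine ⟨⟨sp_le_csp (T.lowerCore_le_sp hA), hn⟩, T.mem_bracketInto.2 ?_⟩
    have h1 := T.adLower_mem hδ hA
    have h2 := T.adLower_mem_homDeg hδ hn
    -- In degrees `0` and `1/2` the bracket with `F` has negative degree but lies in the nonnegative
    -- part, hence is zero.
    by_cases hn2 : n < 2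
    · rw [T.eq_zero_of_nonnegDeg hδ.internal (T.nonneg_of_mem_lowerCore h1) h2 (by omega)]
      exact zero_mem _
    · obtain ⟨m, rfl⟩ := Nat.exists_eq_add_of_le' (not_lt.1 hn2)
      exact ih m (by omega) h1 (by simpa using h2)

/-- The bracket with the grading operator. -/
noncomputable def adGrading : Module.End ℝ (Module.End ℝ X) :=
  LieAlgebra.ad ℝ (Module.End ℝ X) T.grading

-- Stability under the grading operator splits `lowerCore` into eigenspaces, and each of these lies
-- in one algebraic prolongation.
include hδ in
theorem lowerCore_le_uF : T.lowerCore ≤ uF σ G δ := by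
  have := T.finite
  have hsum : nonnegDeg G ≤ ⨆ μ : ℝ, T.adGrading.genEigenspace μ 1 := by
    refine iSup_le fun k A hA => Submodule.mem_iSup_of_mem (k : ℝ) ?_
    rw [Module.End.mem_genEigenspace_one]
    exact_mod_cast (T.mem_homDeg_iff hδ.internal).1 hA
  have hN : T.lowerCore = ⨆ μ : ℝ, T.lowerCore ⊓ T.adGrading.genEigenspace μ 1 := by
    rw [← Submodule.inf_iSup_genEigenspace (fun A hA => T.grading_lie_mem hδ hA) 1, eq_comm,
      inf_eq_left]
    exact fun A hA => hsum (T.nonneg_of_mem_lowerCore hA)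
  rw [hN]
  refine iSup_le fun μ A hA => ?_
  obtain ⟨hA, hμ⟩ := hA
  rw [SetLike.mem_coe, Module.End.mem_genEigenspace_one] at hμ
  by_cases h0 : A = 0
  · rw [h0]; exact zero_mem _
  obtain ⟨ρ, a, ρ', c, h⟩ : ∃ (ρ : D.Row) (a : ℕ) (ρ' : D.Row) (c : ℕ),
      T.coef ρ' c (A (T.vec ρ a)) ≠ 0 := by
    by_contra! h
    exact h0 (T.map_ext fun ρ a _ => T.ext_coef fun ρ' c _ => by simp [h])
  have h1 := T.coef_grading_lie A ρ a ρ' c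
  change T.coef ρ' c (T.adGrading A _) = _ at h1
  -- A nonzero matrix entry identifies `μ` with a difference of weights, which nonnegativity makes a
  -- natural number.
  rw [hμ, LinearMap.smul_apply, map_smul, smul_eq_mul] at h1
  have h2 := mul_right_cancel₀ h h1
  obtain ⟨n, hn⟩ : ∃ n : ℕ, D.left ρ' - 2 * c = D.left ρ - 2 * a + n := by
    refine ⟨(D.left ρ' - 2 * c - (D.left ρ - 2 * a)).toNat, ?_⟩
    have : ¬ (D.left ρ' - 2 * c < D.left ρ - 2 * a) := fun h' =>
      h (T.coef_eq_zero_of_nonnegDeg hδ.internal (T.nonneg_of_mem_lowerCore hA) h')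
    omega
  have h3 : μ = (n : ℤ) := by
    have : ((D.left ρ' - 2 * c : ℤ) : ℝ) = ((D.left ρ - 2 * a + n : ℤ) : ℝ) := by rw [hn]
    push_cast at this ⊢
    linarith
  exact le_iSup (flagProlong σ G δ) _ (T.mem_flagProlong hδ n hA
    ((T.mem_homDeg_iff hδ.internal).2 (h3 ▸ hμ)))

lemma smul_one_add_mem_lowerCore {A : Module.End ℝ X} (h : A ∈ sp σ) (d : ℝ) {P : Module.End ℝ X}
    (hP : P ∈ T.lowerCore) (e : A = d • 1 + P) : A ∈ T.lowerCore := by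
  have e' : A - P = d • 1 := by rw [e]; abel
  have h1 : A - P ∈ T.lowerCore := by
    refine T.mem_lowerCore_of_adLower_mem (sub_mem h hP.1) ?_ ?_
    · rw [e']
      exact Submodule.smul_mem _ _ (homDeg_le_nonnegDeg 0 one_mem_homDeg)
    · rw [e', map_smul, adLower_apply, Ring.lie_def, mul_one, one_mul, sub_self, smul_zero]
      exact zero_mem _
  have := add_mem h1 hP
  rwa [sub_add_cancel] at this

lemma exists_smul_one_add {A : Module.End ℝ X} (hA : A ∈ csp σ) :
    ∃ d : ℝ, A - d • 1 ∈ sp σ := by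
  obtain ⟨c, hc⟩ := hA
  refine ⟨c / 2, fun x y => ?_⟩
  have := hc x y
  simp only [LinearMap.sub_apply, LinearMap.smul_apply, Module.End.one_apply, map_sub, map_smul,
    smul_eq_mul]
  linarith

lemma trace_lower_mul_raise_ne_zero [Nonempty D.Row] (h : ∀ ρ, 2 ≤ D.len ρ) :
    LinearMap.trace ℝ X (T.lower * T.raise) ≠ 0 := by
  classical
  rw [LinearMap.trace_eq_matrix_trace ℝ T.basis, Matrix.trace]
  have key : ∀ x : D.Box, (LinearMap.toMatrix T.basis T.basis (T.lower * T.raise)).diag x =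
      (x.2 : ℕ) * ((D.len x.1 : ℝ) - (x.2 : ℕ)) := by
    rintro ⟨ρ, a, ha⟩
    rw [Matrix.diag_apply, LinearMap.toMatrix_apply, Module.End.mul_apply, basis_eq_vec]
    change T.basis.coord ⟨ρ, a, ha⟩ _ = _
    rw [← coef_of_lt T ha]
    cases a with
    | zero => simp [raise_vec_zero]
    | succ a =>
      simp only [raise_vec_succ, map_smul, lower_vec]
      rw [coef_vec T ha, if_pos rfl]
      simp
  refine ne_of_gt (Finset.sum_pos' (fun x _ => ?_) ?_)
  · rw [key]
    have : ((x.2 : ℕ) : ℝ) ≤ D.len x.1 := by exact_mod_cast x.2.2.le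
    exact mul_nonneg (Nat.cast_nonneg _) (by linarith)
  · obtain ⟨ρ⟩ := ‹Nonempty D.Row›
    refine ⟨⟨ρ, 1, h ρ⟩, Finset.mem_univ _, ?_⟩
    rw [key]
    have : (2 : ℝ) ≤ D.len ρ := by exact_mod_cast h ρ
    simp only [Nat.cast_one, one_mul]
    linarith

-- The `𝔰𝔩₂`-triple does not prolong to degree `2`. Three brackets with `F` turn `A` into `-2c F`,
-- while invariance of the trace form gives `tr((ad F)³ A · E) = -tr(A · (ad F)³ E) = 0`; but `tr(F
-- E) ≠ 0`.
include hδ in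
lemma raise_coef_eq_zero [Nonempty D.Row] (h : ∀ ρ, 2 ≤ D.len ρ) {A P : Module.End ℝ X} {c : ℝ}
    (hA : A ∈ homDeg G 4) (hP : P ∈ T.lowerCore) (e : T.adLower A = c • T.raise + P) : c = 0 := by
  have hP1 : P ∈ homDeg G 2 := by
    have : P = T.adLower A - c • T.raise := by rw [e]; abel
    rw [this]
    exact sub_mem (T.adLower_mem_homDeg hδ hA)
      (Submodule.smul_mem _ _ (T.raise_mem_homDeg hδ.internal))
  have hP2 : T.adLower (T.adLower P) = 0 :=
    T.eq_zero_of_nonnegDeg hδ.internal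
      (T.nonneg_of_mem_lowerCore (T.adLower_mem hδ (T.adLower_mem hδ hP)))
      (T.adLower_mem_homDeg hδ (T.adLower_mem_homDeg hδ hP1)) (by norm_num)
  have h3 : T.adLower (T.adLower (T.adLower A)) = (-2 * c) • T.lower := by
    rw [e, map_add, map_add, hP2, map_smul, map_smul, adLower_raise, map_neg, adLower_neutral,
      add_zero, smul_neg, smul_smul, ← neg_smul]
    congr 1; ring
  have htr : ∀ A B : Module.End ℝ X, LinearMap.trace ℝ X (T.adLower A * B) =
      -LinearMap.trace ℝ X (A * T.adLower B) := by
    intro A B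
    simp only [adLower_apply, Ring.lie_def, sub_mul, mul_sub, map_sub]
    rw [← mul_assoc, ← mul_assoc, mul_assoc T.lower A B, LinearMap.trace_mul_comm ℝ T.lower (A * B)]
    ring
  have hR : T.adLower (T.adLower (T.adLower T.raise)) = 0 := by
    rw [adLower_raise, map_neg, adLower_neutral, map_neg, map_smul, adLower_apply, lie_self,
      smul_zero, neg_zero]
  have h4 := congrArg (fun B => LinearMap.trace ℝ X (B * T.raise)) h3
  simp only [htr, hR, mul_zero, map_zero, neg_zero, smul_mul_assoc, map_smul, smul_eq_mul] at h4
  have := (mul_eq_zero.1 h4.symm).resolve_right (T.trace_lower_mul_raise_ne_zero h)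
  linarith

-- Induction on the degree, removing at each stage the multiple of `H`, `E` or `1` that keeps `[F,
-- A]` outside `lowerCore`. Only degrees `0` and `1` contribute new terms.
include hδ in
lemma flagProlong_decomposition [Nonempty D.Row] (h : ∀ ρ, 2 ≤ D.len ρ) (n : ℕ)
    {A : Module.End ℝ X} (hA : A ∈ flagProlong σ G δ (n + 2)) :
    ∃ b c d : ℝ, ∃ P ∈ T.lowerCore, A = b • T.neutral + c • T.raise + d • 1 + P ∧
      (n ≠ 0 → b = 0 ∧ d = 0) ∧ (n ≠ 2 → c = 0) := by
  induction n using Nat.strong_induction_on generalizing A with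
  | _ n ih =>
    obtain ⟨⟨hcsp, hdeg⟩, hbr⟩ := hA
    rw [SetLike.mem_coe, T.mem_bracketInto] at hbr
    have hpos : A ∈ nonnegDeg G := homDeg_le_nonnegDeg n hdeg
    match n, ih, hdeg, hbr with
    | 0, _, hdeg, hbr =>
      obtain ⟨a, ha⟩ := T.mem_symbol_iff.1 hbr
      obtain ⟨d, hd⟩ := exists_smul_one_add hcsp
      -- The half compensates `[F, H] = 2F`.
      refine ⟨a / 2, 0, d, A - d • 1 - (a / 2) • T.neutral, ?_, ?_, fun h => absurd rfl h,
        fun _ => rfl⟩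
      · refine T.mem_lowerCore_of_adLower_mem (sub_mem hd (Submodule.smul_mem _ _ T.neutral_mem_sp))
          (sub_mem (sub_mem hpos (Submodule.smul_mem _ _ (homDeg_le_nonnegDeg 0 one_mem_homDeg)))
            (Submodule.smul_mem _ _ (homDeg_le_nonnegDeg 0 (T.neutral_mem_homDeg hδ.internal)))) ?_
        rw [map_sub, map_sub, map_smul, map_smul, ← ha, adLower_neutral, adLower_apply,
          Ring.lie_def, mul_one, one_mul, sub_self, smul_zero, sub_zero, smul_smul,
          div_mul_cancel₀ a two_ne_zero, sub_self]
        exact zero_mem _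
      · rw [zero_smul]; abel
    | 1, _, hdeg, hbr =>
      refine ⟨0, 0, 0, A, ?_, by simp, fun _ => ⟨rfl, rfl⟩, fun _ => rfl⟩
      refine T.mem_lowerCore_of_adLower_mem (T.mem_sp_of_homDeg hδ hcsp hdeg (by norm_num)) hpos ?_
      rw [(Submodule.mem_bot ℝ).1 hbr]
      exact zero_mem _
    | n + 2, ih, hdeg, hbr =>
      have hsp : A ∈ sp σ := T.mem_sp_of_homDeg hδ hcsp hdeg (by omega)
      obtain ⟨b, c, d, P, hP, e, h1, h2⟩ := ih n (by omega) hbr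
      by_cases hn : n = 0
      · subst hn
        rw [h2 (by norm_num), zero_smul, add_zero] at e
        -- Since `[F, E] = -H`, adding `b E` cancels the `H`-term of `[F, A]`.
        have hsp' : A + b • T.raise ∈ sp σ :=
          add_mem hsp (Submodule.smul_mem _ _ (T.raise_mem_sp hδ))
        refine ⟨0, -b, 0, A + b • T.raise, ?_, by simp, fun _ => ⟨rfl, rfl⟩, fun h => absurd rfl h⟩
        refine T.mem_lowerCore_of_adLower_mem hsp' (add_mem hpos
          (Submodule.smul_mem _ _ (homDeg_le_nonnegDeg 2 (T.raise_mem_homDeg hδ.internal)))) ?_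
        refine T.smul_one_add_mem_lowerCore (lie_mem_sp (T.lower_mem_sp hδ) hsp') d hP ?_
        rw [map_add, map_smul, e, adLower_raise, smul_neg]
        abel
      · obtain ⟨rfl, rfl⟩ := h1 hn
        have hc : c = 0 := by
          by_cases hn2 : n = 2
          · subst hn2
            exact T.raise_coef_eq_zero hδ h hdeg hP (by rw [e]; simp)
          · exact h2 hn2
        refine ⟨0, 0, 0, A, ?_, by simp, fun _ => ⟨rfl, rfl⟩, fun _ => rfl⟩
        refine T.mem_lowerCore_of_adLower_mem hsp hpos ?_
        rw [e, hc]
        simpa using hP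

include hδ in
theorem uF_decomposition [Nonempty D.Row] (h : ∀ ρ, 2 ≤ D.len ρ) {A : Module.End ℝ X}
    (hA : A ∈ uF σ G δ) : ∃ a b c d : ℝ, ∃ P ∈ T.lowerCore,
      A = a • T.lower + b • T.neutral + c • T.raise + d • 1 + P := by
  refine Submodule.iSup_induction (flagProlong σ G δ) (motive := fun A => ∃ a b c d : ℝ,
    ∃ P ∈ T.lowerCore, A = a • T.lower + b • T.neutral + c • T.raise + d • 1 + P) hA ?_
    ⟨0, 0, 0, 0, 0, zero_mem _, by simp⟩ ?_
  · intro n A hA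
    match n, hA with
    | 0, hA =>
      obtain ⟨a, ha⟩ := T.mem_symbol_iff.1 hA
      exact ⟨a, 0, 0, 0, 0, zero_mem _, by simp [ha]⟩
    | 1, hA => exact ⟨0, 0, 0, 0, 0, zero_mem _, by simpa [flagProlong] using hA⟩
    | n + 2, hA =>
      obtain ⟨b, c, d, P, hP, e, -⟩ := T.flagProlong_decomposition hδ h n hA
      exact ⟨0, b, c, d, P, hP, by rw [e, zero_smul, zero_add]⟩
  · rintro A B ⟨a, b, c, d, P, hP, rfl⟩ ⟨a', b', c', d', Q, hQ, rfl⟩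
    exact ⟨a + a', b + b', c + c', d + d', P + Q, add_mem hP hQ, by module⟩

end Tableau

/-! ### Prolongation equations on a single row -/

section RowEquations

/-- The coordinate with index `k` of the image of the vector with index `j` of a row of length `n`
under the combination with coefficients `a`, `b`, `c`, `d` of the lowering operator, the weight
operator, the raising operator and the identity. -/
noncomputable def rowCoef (n : ℕ) (a b c d : ℝ) (j k : ℕ) : ℝ :=
  (if k = j + 1 then a else 0) + (if k = j then b * ((n : ℝ) - 1 - 2 * j) + d else 0) +
    (if k + 1 = j then c * (j * ((n : ℝ) - j)) else 0)

variable {n : ℕ} {a b c d : ℕ → ℝ}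

/-- At `k = j + 1` only `F` contributes on the left. The right side lives on `k = i - 1, i, i + 1`,
which the assumption on `i` and `j` avoids. The next lemma does the same for `E` at `k = j - 1`. -/
lemma lower_coef_eq_zero {i j : ℕ}
    (h : ∀ k < n, rowCoef n (a i) (b i) (c i) (d i) j k = rowCoef n (a j) (b j) (c j) (d j) i k)
    (hj : j + 1 < n) (hij : i < j ∨ j + 3 ≤ i) : a i = 0 := by
  have := h (j + 1) hj
  simp only [rowCoef] at this
  split_ifs at this <;> first | (exfalso; omega) | linarith

lemma raise_coef_eq_zero {i j : ℕ}
    (h : ∀ k < n, rowCoef n (a i) (b i) (c i) (d i) j k = rowCoef n (a j) (b j) (c j) (d j) i k)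
    (hj : j < n) (h0 : 0 < j) (hij : j < i ∨ i + 3 ≤ j) : c i = 0 := by
  have := h (j - 1) (by omega)
  simp only [rowCoef] at this
  have hne : (j : ℝ) * ((n : ℝ) - j) ≠ 0 := by
    refine mul_ne_zero (by exact_mod_cast h0.ne') ?_
    rw [sub_ne_zero]
    exact_mod_cast hj.ne'
  refine (mul_eq_zero.1 (?_ : c i * ((j : ℝ) * ((n : ℝ) - j)) = 0)).resolve_right hne
  split_ifs at this <;> first | (exfalso; omega) | linarith

lemma neutral_coef_eq_zero {i j j' : ℕ} (hj : b i * ((n : ℝ) - 1 - 2 * j) + d i = 0)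
    (hj' : b i * ((n : ℝ) - 1 - 2 * j') + d i = 0) (hne : j ≠ j') : b i = 0 ∧ d i = 0 := by
  have h : b i * ((j : ℝ) - j') = 0 := by linarith
  have hb := (mul_eq_zero.1 h).resolve_right (sub_ne_zero.2 (by exact_mod_cast hne))
  rw [hb, zero_mul, zero_add] at hj
  exact ⟨hb, hj⟩

lemma diag_coef_eq_zero {i j : ℕ}
    (h : ∀ k < n, rowCoef n (a i) (b i) (c i) (d i) j k = rowCoef n (a j) (b j) (c j) (d j) i k)
    (ha : ∀ i < n, a i = 0) (hc : ∀ i < n, c i = 0) (hi : i < n) (hj : j < n) (hij : i ≠ j) :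
    b i * ((n : ℝ) - 1 - 2 * j) + d i = 0 := by
  have := h j hj
  simp only [rowCoef, ha i hi, ha j hj, hc i hi, hc j hj] at this
  split_ifs at this <;> first | (exfalso; omega) | linarith

/-- The first prolongation of `𝔤𝔩₂` acting on an irreducible space of dimension at least `4`
vanishes. -/
theorem row_coefs_eq_zero (hn : 4 ≤ n)
    (h : ∀ i < n, ∀ j < n, ∀ k < n,
      rowCoef n (a i) (b i) (c i) (d i) j k = rowCoef n (a j) (b j) (c j) (d j) i k) :
    ∀ i < n, a i = 0 ∧ b i = 0 ∧ c i = 0 ∧ d i = 0 := by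
  have c0 : c 0 = 0 := raise_coef_eq_zero (h 0 (by omega) 3 (by omega)) (by omega) (by omega)
    (by omega)
  have ha : ∀ i < n, a i = 0 := by
    intro i hi
    rcases lt_trichotomy i 2 with h2 | rfl | h2
    · exact lower_coef_eq_zero (h i hi (i + 1) (by omega)) (by omega) (by omega)
    -- In a row of four boxes no `j` separates the two sides for `i = 2`; the equation used here
    -- couples `a 2` only to `c 0`. Similarly `c 1` is coupled below only to `a 3`.
    · have := h 2 hi 0 (by omega) 1 (by omega)
      simpa [rowCoef, c0] using this
    · exact lower_coef_eq_zero (h i hi 0 (by omega)) (by omega) (by omega)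
  have hc : ∀ i < n, c i = 0 := by
    intro i hi
    rcases lt_trichotomy i 1 with h1 | rfl | h1
    · rw [Nat.lt_one_iff.1 h1, c0]
    · have := h 1 hi 3 (by omega) 2 (by omega)
      have hne : (n : ℝ) - 3 ≠ 0 := sub_ne_zero.2 (by exact_mod_cast (by omega : n ≠ 3))
      simpa [rowCoef, ha 3 (by omega), hne] using this
    · exact raise_coef_eq_zero (h i hi 1 (by omega)) (by omega) (by omega) (by omega)
  intro i hi
  obtain ⟨j, j', hj, hj', h1, h2, h3⟩ : ∃ j j', j < n ∧ j' < n ∧ i ≠ j ∧ i ≠ j' ∧ j ≠ j' := by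
    rcases lt_trichotomy i 1 with h1 | rfl | h1
    · exact ⟨1, 2, by omega⟩
    · exact ⟨0, 2, by omega⟩
    · exact ⟨0, 1, by omega⟩
  have := neutral_coef_eq_zero (diag_coef_eq_zero (h i hi j hj) ha hc hi hj h1)
    (diag_coef_eq_zero (h i hi j' hj') ha hc hi hj' h2) h3
  exact ⟨ha i hi, this.1, hc i hi, this.2⟩

/-- The first Tanaka prolongation of `𝔤𝔩₂` acting on the Heisenberg algebra of an irreducible
symplectic space of dimension at least `6` vanishes. -/
theorem symplectic_row_coefs_eq_zero (hn : 6 ≤ n) (hn' : Even n)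
    (h : ∀ i < n, ∀ j < n, i + j + 1 ≠ n → ∀ k < n,
      rowCoef n (a i) (b i) (c i) (d i) j k = rowCoef n (a j) (b j) (c j) (d j) i k) :
    ∀ i < n, a i = 0 ∧ b i = 0 ∧ c i = 0 ∧ d i = 0 := by
  obtain ⟨m, rfl⟩ := hn'
  have ha : ∀ i < m + m, a i = 0 := by
    intro i hi
    obtain ⟨j, h1, h2, h3⟩ : ∃ j, j + 1 < m + m ∧ i + j + 1 ≠ m + m ∧ (i < j ∨ j + 3 ≤ i) := by
      by_cases h2 : i ≤ 2
      -- Parity keeps this choice off the dual box: `i + j + 1` is odd and the length is even. The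
      -- choice `j = i + 4` for `c` works likewise, and at `i = 1` it needs six boxes.
      · exact ⟨i + 2, by omega⟩
      · by_cases h3 : i + 1 = m + m
        · exact ⟨1, by omega⟩
        · exact ⟨0, by omega⟩
    exact lower_coef_eq_zero (h i hi j (by omega) h2) h1 h3
  have hc : ∀ i < m + m, c i = 0 := by
    intro i hi
    obtain ⟨j, h1, h0, h2, h3⟩ : ∃ j, j < m + m ∧ 0 < j ∧ i + j + 1 ≠ m + m ∧
        (j < i ∨ i + 3 ≤ j) := by
      by_cases h2 : i ≤ 1
      · exact ⟨i + 4, by omega⟩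
      · by_cases h3 : i + 2 = m + m
        · exact ⟨2, by omega⟩
        · exact ⟨1, by omega⟩
    exact raise_coef_eq_zero (h i hi j h1 h2) h1 h0 h3
  intro i hi
  obtain ⟨j, j', hj, hj', h1, h2, h3, h4, h5⟩ : ∃ j j', j < m + m ∧ j' < m + m ∧ i ≠ j ∧ i ≠ j' ∧
      j ≠ j' ∧ i + j + 1 ≠ m + m ∧ i + j' + 1 ≠ m + m := by
    by_cases h0 : i = 0 ∨ i + 1 = m + m
    · exact ⟨1, 2, by omega⟩
    · by_cases h1 : i = 1 ∨ i + 2 = m + m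
      · exact ⟨0, 2, by omega⟩
      · exact ⟨0, 1, by omega⟩
  have := neutral_coef_eq_zero (diag_coef_eq_zero (h i hi j hj h4) ha hc hi hj h1)
    (diag_coef_eq_zero (h i hi j' hj' h5) ha hc hi hj' h2) h3
  exact ⟨ha i hi, this.1, hc i hi, this.2⟩

end RowEquations

/-! ### Iterated brackets with `F` between two rows -/

namespace Tableau

variable {X : Type u} [AddCommGroup X] [Module ℝ X] {D : Diagram}
  {σ : LinearMap.BilinForm ℝ X} {G : ℤ → Submodule ℝ X} {δ : Submodule ℝ (Module.End ℝ X)}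
  (T : Tableau σ G δ D)

/-- Coordinates of `(ad F)ᵐ W` on the vectors of a row whose images under `W` are multiples of the
last vector of another row. -/
lemma coef_adLower_pow {ρ ρ' : D.Row} {W : Module.End ℝ X} {ν : ℕ → ℝ} {j₀ : ℕ}
    (h : ∀ j, j₀ ≤ j → j < D.len ρ → ∀ k < D.len ρ',
      T.coef ρ' k (W (T.vec ρ j)) = if k + 1 = D.len ρ' then ν j else 0)
    {m j k : ℕ} (hj : j₀ ≤ j) (hmj : m + j < D.len ρ) (hk : k < D.len ρ') :
    T.coef ρ' k ((T.adLower ^ m) W (T.vec ρ j)) =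
      if k + 1 = D.len ρ' then (-1) ^ m * ν (m + j) else 0 := by
  induction m generalizing j k with
  | zero => simpa using h j hj (by omega) k hk
  | succ m ih =>
    rw [pow_succ', Module.End.mul_apply, adLower_vec, map_sub, ih (by omega) (by omega) hk]
    -- `F` kills the last vector of the row, so only the term that shifts the argument survives.
    have e : T.coef ρ' k (T.lower ((T.adLower ^ m) W (T.vec ρ j))) = 0 := by
      cases k with
      | zero => exact T.coef_lower_zero _ _
      | succ k => rw [T.coef_lower_succ _ hk, ih hj (by omega) (by omega), if_neg (by omega)]
    rw [e, add_right_comm m 1 j, add_assoc, pow_succ]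
    split_ifs <;> ring

/-- The variant for dual rows: the last vector of one pairs only with the first vector of the other,
so the `z`-term appears only at `j = 0`. It is moved by `Fᵐ` on the target, which shifts its index
by `m`, while the `ν`-term is moved on the argument. -/
lemma coef_adLower_pow_zero {ρ ρ' : D.Row} {W : Module.End ℝ X} {ν z : ℕ → ℝ}
    (h : ∀ j < D.len ρ, ∀ k < D.len ρ', T.coef ρ' k (W (T.vec ρ j)) =
      (if k + 1 = D.len ρ' then ν j else 0) - if j = 0 then z k else 0)
    {m k : ℕ} (hm : m < D.len ρ) (hk : k + m < D.len ρ') :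
    T.coef ρ' (k + m) ((T.adLower ^ m) W (T.vec ρ 0)) =
      (if k + m + 1 = D.len ρ' then (-1) ^ m * ν m else 0) - z k := by
  induction m with
  | zero => simpa using h 0 hm k hk
  | succ m ih =>
    have h' : ∀ j, 1 ≤ j → j < D.len ρ → ∀ k < D.len ρ',
        T.coef ρ' k (W (T.vec ρ j)) = if k + 1 = D.len ρ' then ν j else 0 := by
      intro j hj hj' k hk
      rw [h j hj' k hk, if_neg (by omega : j ≠ 0), sub_zero]
    rw [← add_assoc] at hk ⊢
    rw [pow_succ' T.adLower, Module.End.mul_apply, adLower_vec, map_sub,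
      T.coef_lower_succ _ hk, ih (by omega) (by omega), if_neg (by omega),
      T.coef_adLower_pow h' (by omega) (by omega) hk, pow_succ]
    split_ifs <;> ring

variable (hδ : IsSymplecticFlagSymbol σ G δ)

include hδ in
lemma form_vec_alternate (ρ : D.Row) {m c : ℕ} (h : m + c + 1 = D.len ρ) :
    σ (T.vec ρ m) (T.vec (D.star ρ) c) =
      (-1) ^ m * σ (T.vec ρ 0) (T.vec (D.star ρ) (D.len ρ - 1)) := by
  induction m generalizing c with
  | zero =>
    have : c = D.len ρ - 1 := by omega
    rw [this, pow_zero, one_mul]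
  | succ m ih =>
    have h1 := T.lower_mem_sp hδ (T.vec ρ m) (T.vec (D.star ρ) c)
    rw [lower_vec, lower_vec, ih (c := c + 1) (by omega)] at h1
    rw [pow_succ]
    linarith

-- This is how the first condition enters: the last box of `ρ'` lies strictly to the right of the
-- first box of `ρ`, so such an entry would lower the degree.
include hδ in
lemma coef_last_eq_zero (h1 : D.Cond1) {ρ ρ' : D.Row} (hne : ρ ≠ ρ') {A : Module.End ℝ X}
    (hA : A ∈ nonnegDeg G) : T.coef ρ' (D.len ρ' - 1) (A (T.vec ρ 0)) = 0 := by
  refine T.coef_eq_zero_of_nonnegDeg hδ.internal hA ?_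
  have h := h1 ρ ρ' hne
  have := D.len_pos ρ'
  rw [Diagram.right] at h
  push_cast [Nat.cast_sub this]
  omega

include hδ in
lemma coef_combination (a b c d : ℝ) {P : Module.End ℝ X} (hP : P ∈ T.lowerCore) (ρ : D.Row)
    {j k : ℕ} (hj : j < D.len ρ) (hk : k < D.len ρ) :
    T.coef ρ k ((a • T.lower + b • T.neutral + c • T.raise + d • (1 : Module.End ℝ X) + P)
      (T.vec ρ j)) = rowCoef (D.len ρ) a b c (d + T.scalar P ρ) j k := by
  simp only [LinearMap.add_apply, LinearMap.smul_apply, map_add, map_smul, smul_eq_mul,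
    Module.End.one_apply, lower_vec, neutral_vec, T.coef_diag hδ hP ρ hj, rowCoef, coef_vec T hj]
  have e1 : T.coef ρ k (T.vec ρ (j + 1)) = if k = j + 1 then 1 else 0 := by
    by_cases h : j + 1 < D.len ρ
    · exact coef_vec T h k
    · rw [vec_of_le T (by omega), map_zero, if_neg (by omega)]
  have e2 : T.coef ρ k (T.raise (T.vec ρ j)) =
      if k + 1 = j then (j : ℝ) * ((D.len ρ : ℝ) - j) else 0 := by
    cases j with
    | zero => rw [raise_vec_zero, map_zero, if_neg (by omega)]
    | succ j =>
      rw [raise_vec_succ, map_smul, coef_vec T (by omega)]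
      by_cases h : k = j
      · simp [h]
      · simp [h]
  rw [e1, e2]
  split_ifs <;> ring

end Tableau

/-! ### The first prolongation -/

namespace Tableau

variable {X : Type u} [AddCommGroup X] [Module ℝ X] {D : Diagram}
  {σ : LinearMap.BilinForm ℝ X} {G : ℤ → Submodule ℝ X} {δ : Submodule ℝ (Module.End ℝ X)}
  (T : Tableau σ G δ D) (hδ : IsSymplecticFlagSymbol σ G δ)

include hδ in
/-- On the vectors of the diagram, an element of the first prolongation takes values in conformal
multiples of `lowerCore`, and it vanishes modulo the off-diagonal blocks on the own row. -/
lemma firstProlong_vec (h3 : D.Cond3) (h4 : D.Cond4)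
    {g : X →ₗ[ℝ] Module.End ℝ X} {z : X} (hg : ∀ v, g v ∈ uF σ G δ)
    (hsymm : ∀ v w, g v w - g w v = σ v w • z)
    (hconf : ∀ v x y, σ (g v x) y + σ x (g v y) = σ z v * σ x y) (ρ : D.Row) :
    ∀ i < D.len ρ, ∃ d : ℝ, ∃ P ∈ T.lowerCore, g (T.vec ρ i) = d • (1 : Module.End ℝ X) + P ∧
      d + T.scalar P ρ = 0 ∧ 2 * d = σ z (T.vec ρ i) := by
  have hlen : ∀ ρ, 2 ≤ D.len ρ := fun ρ => (D.four_le_len h3 h4 ρ).trans' (by norm_num)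
  have : Nonempty D.Row := ⟨ρ⟩
  choose a b c d P hP e using fun i => T.uF_decomposition hδ hlen (hg (T.vec ρ i))
  have hrow : ∀ i < D.len ρ, ∀ j < D.len ρ, σ (T.vec ρ i) (T.vec ρ j) = 0 → ∀ k < D.len ρ,
      rowCoef (D.len ρ) (a i) (b i) (c i) (d i + T.scalar (P i) ρ) j k =
        rowCoef (D.len ρ) (a j) (b j) (c j) (d j + T.scalar (P j) ρ) i k := by
    intro i hi j hj hij k hk
    have h := congrArg (T.coef ρ k) (hsymm (T.vec ρ i) (T.vec ρ j))
    rw [hij, zero_smul, map_zero, map_sub, e i, e j, T.coef_combination hδ _ _ _ _ (hP i) ρ hj hk,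
      T.coef_combination hδ _ _ _ _ (hP j) ρ hi hk] at h
    exact sub_eq_zero.1 h
  have hzero : ∀ i < D.len ρ, a i = 0 ∧ b i = 0 ∧ c i = 0 ∧ d i + T.scalar (P i) ρ = 0 := by
    by_cases hρ : D.star ρ = ρ
    · exact symplectic_row_coefs_eq_zero (D.six_le_len h4 ρ hρ) (D.even_len_of_star_eq ρ hρ)
        (d := fun i => d i + T.scalar (P i) ρ)
        fun i hi j hj hij => hrow i hi j hj (T.form_vec_eq_zero fun _ => hij)
    · exact row_coefs_eq_zero (D.four_le_len h3 h4 ρ) (d := fun i => d i + T.scalar (P i) ρ)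
        fun i hi j hj => hrow i hi j hj (T.form_vec_eq_zero fun h => absurd h.symm hρ)
  intro i hi
  obtain ⟨ha, hb, hc, hd⟩ := hzero i hi
  have hgi : g (T.vec ρ i) = d i • (1 : Module.End ℝ X) + P i := by
    rw [e i, ha, hb, hc]; simp
  refine ⟨d i, P i, hP i, hgi, hd, ?_⟩
  have hw : 0 + (D.len ρ - 1) + 1 = D.len ρ := by have := D.len_pos ρ; omega
  -- The conformal factor of `d • 1 + P` with `P ∈ 𝔰𝔭(X)` is `2d`; one nonorthogonal pair detects
  -- it.
  have h1 := hconf (T.vec ρ i) (T.vec ρ 0) (T.vec (D.star ρ) (D.len ρ - 1))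
  have h2 := T.lowerCore_le_sp (hP i) (T.vec ρ 0) (T.vec (D.star ρ) (D.len ρ - 1))
  simp only [hgi, LinearMap.add_apply, LinearMap.smul_apply, Module.End.one_apply, map_add,
    map_smul, smul_eq_mul] at h1
  refine mul_right_cancel₀ (T.form_vec_ne_zero hw) ?_
  linarith

include hδ in
/-- The first Tanaka prolongation of `𝔲^F(δ)` is contained in the standard prolongation of `𝔭`. -/
theorem firstProlong_le (h1 : D.Cond1) (h3 : D.Cond3) (h4 : D.Cond4)
    {g : X →ₗ[ℝ] Module.End ℝ X} {z : X} (hg : ∀ v, g v ∈ uF σ G δ)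
    (hsymm : ∀ v w, g v w - g w v = σ v w • z)
    (hconf : ∀ v x y, σ (g v x) y + σ x (g v y) = σ z v * σ x y) :
    z = 0 ∧ ∀ v, g v ∈ T.p := by
  choose d P hP e hd hdz using fun ρ => T.firstProlong_vec hδ h3 h4 hg hsymm hconf ρ
  -- The symmetry identity for a vector of `ρ` and the last vector of `ρ'`, read in row `ρ'`. There
  -- the multiple of `1` in the value on the last vector is invisible, and the other value acts on
  -- its own row by a scalar.
  have hcross : ∀ ρ ρ' (hne : ρ ≠ ρ') (h' : D.len ρ' - 1 < D.len ρ') (j : ℕ) (hj : j < D.len ρ),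
      ∀ k < D.len ρ', T.coef ρ' k (P ρ' (D.len ρ' - 1) h' (T.vec ρ j)) =
        (if k + 1 = D.len ρ' then d ρ j hj + T.scalar (P ρ j hj) ρ' else 0) -
          σ (T.vec ρ j) (T.vec ρ' (D.len ρ' - 1)) * T.coef ρ' k z := by
    intro ρ ρ' hne h' j hj k hk
    have h := congrArg (T.coef ρ' k) (hsymm (T.vec ρ j) (T.vec ρ' (D.len ρ' - 1)))
    rw [e ρ j hj, e ρ' _ h'] at h
    simp only [LinearMap.add_apply, LinearMap.smul_apply, Module.End.one_apply, map_add, map_sub,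
      map_smul, smul_eq_mul, coef_vec T h', T.coef_vec_of_ne hne.symm,
      T.coef_diag hδ (hP ρ j hj) ρ' h'] at h
    by_cases hk' : k + 1 = D.len ρ'
    · rw [if_pos hk']
      rw [if_pos (by omega), if_pos (by omega)] at h
      linarith
    · rw [if_neg hk']
      rw [if_neg (by omega), if_neg (by omega)] at h
      linarith
  have hz : ∀ ρ m, m < D.len ρ → σ (T.vec ρ m) z = 0 := by
    intro ρ m hm
    have halt : σ z (T.vec ρ m) = -σ (T.vec ρ m) z := (LinearMap.IsAlt.neg hδ.alt _ _).symm
    have hs := T.scalar_star hδ (hP ρ m hm) ρ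
    have hd' := hd ρ m hm
    have hdz' := hdz ρ m hm
    by_cases hρ : D.star ρ = ρ
    · rw [hρ] at hs
      linarith
    have hpos := D.len_pos ρ
    have hl : D.len (D.star ρ) - 1 < D.len (D.star ρ) := by rw [D.len_star]; omega
    have hW := hP (D.star ρ) _ hl
    have key := T.coef_adLower_pow_zero (ρ := ρ) (ρ' := D.star ρ)
      (W := P (D.star ρ) _ hl)
      (ν := fun j => if hj : j < D.len ρ then d ρ j hj + T.scalar (P ρ j hj) (D.star ρ) else 0)
      (z := fun k => σ (T.vec ρ 0) (T.vec (D.star ρ) (D.len ρ - 1)) * T.coef (D.star ρ) k z)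
      (fun j hj k hk => by
        rw [hcross ρ _ (Ne.symm hρ) hl j hj k hk, dif_pos hj, D.len_star]
        congr 1
        by_cases hj0 : j = 0
        · rw [if_pos hj0, hj0]
        · rw [if_neg hj0, T.form_vec_eq_zero fun _ => by omega, zero_mul])
      (m := m) (k := D.len ρ - 1 - m) hm (by rw [D.len_star]; omega)
    have hmk : D.len ρ - 1 - m + m = D.len (D.star ρ) - 1 := by rw [D.len_star]; omega
    rw [hmk, T.coef_last_eq_zero hδ h1 (Ne.symm hρ) ((T.mem_lowerCore.1 hW).2 m),
      if_pos (by omega), dif_pos hm] at key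
    have hv : σ (T.vec ρ m) z = (-1) ^ m * (σ (T.vec ρ 0) (T.vec (D.star ρ) (D.len ρ - 1)) *
        T.coef (D.star ρ) (D.len ρ - 1 - m) z) := by
      have hmc : m + (D.len ρ - 1 - m) + 1 = D.len ρ := by omega
      rw [T.form_vec_left hmc, T.form_vec_alternate hδ ρ hmc, mul_assoc]
    -- The two signs cancel, so `σ(v, z)` equals `d` plus the scalar on the dual row. That scalar is
    -- `d` again, and `2d = σ(z, v) = -σ(v, z)`; hence `σ(v, z) = 0`.
    rw [← sub_eq_zero.1 key.symm, ← mul_assoc, ← mul_pow] at hv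
    norm_num at hv
    linarith
  have z0 : z = 0 := by
    refine hδ.nondegenerate.2 z fun x => ?_
    suffices h : LinearMap.flip σ z = 0 from LinearMap.congr_fun h x
    exact T.map_ext fun ρ m hm => hz ρ m hm
  have hd0 : ∀ ρ m (hm : m < D.len ρ), d ρ m hm = 0 := by
    intro ρ m hm
    have := hdz ρ m hm
    rw [z0, map_zero, LinearMap.zero_apply] at this
    linarith
  have hscalar : ∀ ρ m (hm : m < D.len ρ) ρ', T.scalar (P ρ m hm) ρ' = 0 := by
    intro ρ m hm ρ'
    have hown : T.scalar (P ρ m hm) ρ = 0 := by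
      have := hd ρ m hm
      rwa [hd0, zero_add] at this
    by_cases hρ : ρ' = ρ
    · rw [hρ, hown]
    by_cases hρ' : ρ' = D.star ρ
    · rw [hρ', T.scalar_star hδ (hP ρ m hm), hown, neg_zero]
    have hpos := D.len_pos ρ'
    have hl : D.len ρ' - 1 < D.len ρ' := by omega
    have hW := hP ρ' _ hl
    -- With `z = 0` no vector is exceptional, and the `m`-th bracket isolates the scalar of the
    -- `m`-th vector of `ρ` on row `ρ'`.
    have key := T.coef_adLower_pow (ρ := ρ) (ρ' := ρ') (W := P ρ' _ hl) (j₀ := 0)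
      (ν := fun j => if hj : j < D.len ρ then d ρ j hj + T.scalar (P ρ j hj) ρ' else 0)
      (fun j _ hj k hk => by
        rw [hcross ρ _ (Ne.symm hρ) hl j hj k hk, dif_pos hj, z0, map_zero, mul_zero, sub_zero])
      (m := m) (j := 0) le_rfl hm hl
    rw [T.coef_last_eq_zero hδ h1 (Ne.symm hρ) ((T.mem_lowerCore.1 hW).2 m),
      if_pos (by omega), add_zero, dif_pos hm, hd0, zero_add] at key
    exact (mul_eq_zero.1 key.symm).resolve_left (pow_ne_zero _ (by norm_num))
  refine ⟨z0, fun v => ?_⟩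
  rw [← T.basis.sum_repr v, map_sum]
  refine Submodule.sum_mem _ fun x _ => ?_
  rw [map_smul, basis_eq_vec, e x.1 x.2 x.2.2, hd0, zero_smul, zero_add]
  exact Submodule.smul_mem _ _ (T.mem_p_of_scalar_eq_zero hδ (hP _ _ _) fun ρ' => hscalar _ _ _ ρ')

end Tableau

/-! ### Recursive form of the standard prolongation -/

section Symmetric

variable {X : Type u} [AddCommGroup X] [Module ℝ X]

/-- Adjacent transpositions generate the symmetric group. The first one is the exchange of the two
leading arguments; all others fix the leading argument. -/
lemma map_perm_of_curryLeft {n : ℕ} {t : MultilinearMap ℝ (fun _ : Fin (n + 2) => X) X}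
    (h : ∀ v w, (t.curryLeft v).curryLeft w = (t.curryLeft w).curryLeft v)
    (h' : ∀ v (e : Equiv.Perm (Fin (n + 1))) (u : Fin (n + 1) → X),
      t.curryLeft v (u ∘ e) = t.curryLeft v u)
    (e : Equiv.Perm (Fin (n + 2))) (v : Fin (n + 2) → X) : t (v ∘ e) = t v := by
  let S : Submonoid (Equiv.Perm (Fin (n + 2))) :=
    { carrier := {e | ∀ v : Fin (n + 2) → X, t (v ∘ e) = t v}
      one_mem' := fun v => rfl
      mul_mem' := fun {a b} ha hb v => by
        have := hb (v ∘ a)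
        rw [ha] at this
        exact this }
  suffices hS : S = ⊤ from (hS ▸ Submonoid.mem_top e : e ∈ S) v
  rw [eq_top_iff, ← Equiv.Perm.mclosure_swap_castSucc_succ, Submonoid.closure_le]
  rintro _ ⟨i, rfl⟩ v
  refine Fin.cases ?_ (fun j => ?_) i
  · have key : ∀ v : Fin (n + 2) → X,
        t v = (t.curryLeft (v 0)).curryLeft (v 1) (Fin.tail (Fin.tail v)) := by
      intro v
      rw [MultilinearMap.curryLeft_apply, MultilinearMap.curryLeft_apply]
      congr 1
      have h1 : Fin.cons (v 1) (Fin.tail (Fin.tail v)) = Fin.tail v := Fin.cons_self_tail (Fin.tail v)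
      rw [h1, Fin.cons_self_tail]
    change t (v ∘ Equiv.swap 0 1) = t v
    rw [key, key v, h]
    simp only [Function.comp_apply, Equiv.swap_apply_left, Equiv.swap_apply_right]
    congr 1
  · have e1 : v ∘ Equiv.swap (Fin.succ j).castSucc (Fin.succ j).succ =
        Fin.cons (v 0) (Fin.tail v ∘ Equiv.swap j.castSucc j.succ) := by
      funext k
      refine Fin.cases ?_ (fun k => ?_) k
      · rw [Function.comp_apply, Equiv.swap_apply_of_ne_of_ne]
        · rfl
        · exact (Fin.succ_ne_zero j.castSucc).symm
        · exact (Fin.succ_ne_zero _).symm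
      · rw [Fin.cons_succ, Function.comp_apply, Function.comp_apply, ← Fin.succ_castSucc,
          (Fin.succ_injective _).swap_apply]
        rfl
    have h1 := h' (v 0) (Equiv.swap j.castSucc j.succ) (Fin.tail v)
    rw [MultilinearMap.curryLeft_apply, MultilinearMap.curryLeft_apply, ← e1,
      Fin.cons_self_tail] at h1
    exact h1

/-- Peeling off the first argument brings the standard prolongation into the recursive form of the
Tanaka prolongation. -/
lemma mem_stdProlong_succ {P : Submodule ℝ (Module.End ℝ X)} {n : ℕ}
    {t : MultilinearMap ℝ (fun _ : Fin (n + 2) => X) X} :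
    t ∈ stdProlong P (n + 1) ↔ (∀ v, t.curryLeft v ∈ stdProlong P n) ∧
      ∀ v w, (t.curryLeft v).curryLeft w = (t.curryLeft w).curryLeft v := by
  have hcurry : ∀ (v : X) (u : Fin n → X),
      (t.curryLeft v).curryRight u = t.curryRight (Fin.cons v u : Fin (n + 1) → X) := by
    intro v u
    ext x
    change t (Fin.cons v (Fin.snoc u x)) = t (Fin.snoc (Fin.cons v u) x)
    rw [Fin.cons_snoc_eq_snoc_cons]
  constructor
  · rintro ⟨h, h'⟩
    refine ⟨fun v => ⟨fun e u => ?_, fun u => ?_⟩, fun v w => ?_⟩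
    · have := h (Equiv.Perm.decomposeFin.symm (0, e)) (Fin.cons v u)
      rw [MultilinearMap.curryLeft_apply, MultilinearMap.curryLeft_apply, ← this]
      congr 1
      funext k
      refine Fin.cases ?_ (fun k => ?_) k
      · simp
      · simp
    · rw [hcurry]
      exact h' _
    · ext u
      have := h (Equiv.swap 0 1) (Fin.cons w (Fin.cons v u))
      simp only [MultilinearMap.curryLeft_apply]
      rw [← this]
      congr 1
      funext k
      refine Fin.cases ?_ (fun k => Fin.cases ?_ (fun k => ?_) k) k
      · rw [Function.comp_apply, Equiv.swap_apply_left]; rfl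
      · change _ = (Fin.cons w (Fin.cons v u) : Fin (n + 2) → X) (Equiv.swap 0 1 1)
        rw [Equiv.swap_apply_right]; rfl
      · rw [Function.comp_apply, Equiv.swap_apply_of_ne_of_ne (Fin.succ_ne_zero _)]
        · rfl
        · exact fun e => Fin.succ_ne_zero k (Fin.succ_injective _ e)
  · rintro ⟨h, h'⟩
    refine ⟨map_perm_of_curryLeft h' fun v e u => (h v).1 e u, fun u => ?_⟩
    rw [← Fin.cons_self_tail u, ← hcurry]
    exact (h _).2 _

end Symmetric

/-! ### Injectivity of the restriction and extension by zero -/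

section Tanaka

variable {X : Type u} [AddCommGroup X] [Module ℝ X] {σ : LinearMap.BilinForm ℝ X}
  {g₀ : Submodule ℝ (Module.End ℝ X)}

lemma ambient_ext {n : ℕ} {f g : Ambient X (n + 2)} (h : onX n f = onX n g)
    (h' : onZ n f = onZ n g) : f = g := Prod.ext h h'

lemma tanaka_le_derivations (n : ℕ) : tanaka σ g₀ (n + 2) ≤ derivations σ n := by
  cases n <;> exact inf_le_left

lemma onX_mem_tanaka {n : ℕ} {f : Ambient X (n + 2)} (hf : f ∈ tanaka σ g₀ (n + 2)) (v : X) :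
    onX n f v ∈ tanaka σ g₀ (n + 1) := by
  cases n with
  | zero => exact Submodule.mem_top
  | succ n => exact hf.2.1 v

lemma onZ_mem_tanaka {n : ℕ} {f : Ambient X (n + 2)} (hf : f ∈ tanaka σ g₀ (n + 2)) :
    onZ n f ∈ tanaka σ g₀ n := by
  cases n with
  | zero => exact Submodule.mem_top
  | succ n => exact hf.2.2

/-- `X` generates the Heisenberg algebra as soon as `σ ≠ 0`, so a derivation is determined by its
values on `X`. -/
lemma eq_zero_of_onX_eq_zero (hσ : ∃ v w, σ v w ≠ 0) {n : ℕ} {f : Ambient X (n + 2)}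
    (hf : f ∈ derivations σ n) (h : onX n f = 0) : f = 0 := by
  obtain ⟨v, w, hvw⟩ := hσ
  refine ambient_ext (by rw [h, map_zero]) ?_
  have := hf.1 v w
  rw [h] at this
  simp only [LinearMap.zero_apply, map_zero, sub_zero] at this
  rw [map_zero]
  exact (smul_eq_zero.1 this).resolve_left hvw

lemma curryLeft_restrictX (n : ℕ) (f : Ambient X (n + 2)) (v : X) :
    (restrictX (n + 1) f).curryLeft v = restrictX n (onX n f v) := by
  ext u
  rfl

lemma restrictX_zero_apply (x : Ambient X 1) (u : Fin 0 → X) : restrictX 0 x u = x := rfl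

lemma eq_zero_of_restrictX_eq_zero (hσ : ∃ v w, σ v w ≠ 0) (n : ℕ) {f : Ambient X (n + 1)}
    (hf : f ∈ tanaka σ g₀ (n + 1)) (h : restrictX n f = 0) : f = 0 := by
  induction n with
  | zero =>
    have := restrictX_zero_apply f ![]
    rw [h] at this
    exact this.symm
  | succ n ih =>
    refine eq_zero_of_onX_eq_zero hσ (tanaka_le_derivations n hf) ?_
    refine LinearMap.ext fun v => ih (onX_mem_tanaka hf v) ?_
    rw [← curryLeft_restrictX, h]
    rfl

/-- The element with given iterated restriction to `X` that vanishes on `η⁻²` together with all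
its values. -/
noncomputable def extendX :
    (n : ℕ) → MultilinearMap ℝ (fun _ : Fin n => X) X →ₗ[ℝ] Ambient X (n + 1)
  | 0 => (MultilinearMap.constLinearEquivOfIsEmpty (R := ℝ) (S := ℝ) (M₁ := fun _ : Fin 0 => X)
      (M₂ := X)).symm.toLinearMap
  | n + 1 => LinearMap.prod
      (LinearMap.compRight ℝ (extendX n) ∘ₗ
        (multilinearCurryLeftEquiv ℝ (fun _ : Fin (n + 1) => X) X).toLinearMap) 0

lemma onX_extendX (n : ℕ) (t : MultilinearMap ℝ (fun _ : Fin (n + 1) => X) X) (v : X) :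
    onX n (extendX (n + 1) t) v = extendX n (t.curryLeft v) := rfl

lemma onZ_extendX (n : ℕ) (t : MultilinearMap ℝ (fun _ : Fin (n + 1) => X) X) :
    onZ n (extendX (n + 1) t) = 0 := rfl

lemma restrictX_extendX (n : ℕ) (t : MultilinearMap ℝ (fun _ : Fin n => X) X) :
    restrictX n (extendX n t) = t := by
  induction n with
  | zero =>
    ext u
    rw [restrictX_zero_apply]
    change t _ = t u
    congr 1
    exact Subsingleton.elim _ _
  | succ n ih =>
    have : (restrictX (n + 1) (extendX (n + 1) t)).curryLeft = t.curryLeft := by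
      ext v : 1
      rw [curryLeft_restrictX, onX_extendX, ih]
    exact (multilinearCurryLeftEquiv ℝ (fun _ : Fin (n + 1) => X) X).injective this

end Tanaka

/-! ### Both inclusions in all positive degrees -/

namespace Tableau

variable {X : Type u} [AddCommGroup X] [Module ℝ X] {D : Diagram}
  {σ : LinearMap.BilinForm ℝ X} {G : ℤ → Submodule ℝ X} {δ : Submodule ℝ (Module.End ℝ X)}
  (T : Tableau σ G δ D) (hδ : IsSymplecticFlagSymbol σ G δ)

-- Extension by zero on `η⁻²` is a derivation: in degree `0` because `𝔭 ⊆ 𝔰𝔭(X)`, in higher degrees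
-- because the multilinear map is symmetric.
include hδ in
lemma extendX_mem_tanaka (n : ℕ) {t : MultilinearMap ℝ (fun _ : Fin (n + 1) => X) X}
    (ht : t ∈ stdProlong T.p n) : extendX (n + 1) t ∈ tanaka σ (uF σ G δ) (n + 2) := by
  induction n with
  | zero =>
    have hA : (onX 0 (extendX 1 t) : Module.End ℝ X) ∈ T.lowerCore := by
      refine T.p_le_lowerCore hδ ?_
      have := ht.2 ![]
      have e : (onX 0 (extendX 1 t) : Module.End ℝ X) = t.curryRight ![] := by
        refine LinearMap.ext fun x => ?_
        change t _ = t _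
        congr 1
        funext i
        rw [Fin.fin_one_eq_zero i]
        rfl
      exact e ▸ this
    refine ⟨⟨fun v w => ?_, trivial⟩, T.lowerCore_le_uF hδ hA⟩
    rw [onZ_extendX, smul_zero, eq_comm]
    have h1 := T.lowerCore_le_sp hA v w
    rw [← LinearMap.IsAlt.neg hδ.alt _ v, ← sub_eq_add_neg] at h1
    exact congrArg ULift.up h1
  | succ n ih =>
    obtain ⟨h, h'⟩ := mem_stdProlong_succ.1 ht
    refine ⟨⟨fun v w => ?_, fun v => ?_⟩, fun v => ?_, ?_⟩
    · rw [onZ_extendX, smul_zero, onX_extendX, onX_extendX]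
      change 0 = onX n _ _ - onX n _ _
      rw [onX_extendX, onX_extendX, h', sub_self]
    · rw [onX_extendX, onZ_extendX, onZ_extendX, map_zero, LinearMap.zero_apply, sub_zero]
    · rw [onX_extendX]
      exact ih (h v)
    · rw [onZ_extendX]
      exact zero_mem _

include T in
lemma exists_form_ne_zero [Nontrivial X] : ∃ v w, σ v w ≠ 0 := by
  obtain ⟨ρ⟩ := T.nonempty_row
  have := D.len_pos ρ
  exact ⟨_, _, T.form_vec_ne_zero (ρ := ρ) (a := 0) (c := D.len ρ - 1) (by omega)⟩

include hδ in
lemma restrictX_mem_stdProlong [Nontrivial X] (h1 : D.Cond1) (h3 : D.Cond3) (h4 : D.Cond4) (n : ℕ)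
    {f : Ambient X (n + 3)} (hf : f ∈ tanaka σ (uF σ G δ) (n + 3)) :
    onZ (n + 1) f = 0 ∧ restrictX (n + 2) f ∈ stdProlong T.p (n + 1) := by
  induction n with
  | zero =>
    let g : X →ₗ[ℝ] Module.End ℝ X := onX 0 ∘ₗ onX 1 f
    have hder := tanaka_le_derivations 1 hf
    obtain ⟨hz, hp⟩ := T.firstProlong_le hδ h1 h3 h4 (g := g) (z := onZ 1 f)
      (fun v => (onX_mem_tanaka hf v).2) (fun v w => (hder.1 v w).symm) (fun v x y => by
        have e1 := (onX_mem_tanaka hf v).1.1 x y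
        -- Evaluating on `[v, z] = 0` gives `[f v, z] = [f z, v]`, which says that `f v` has
        -- conformal factor `σ(f z, v)`.
        have e2 := hder.2 v
        rw [eq_comm, sub_eq_zero] at e2
        rw [e2] at e1
        have e3 := congrArg ULift.down e1
        change σ x y * σ (onZ 1 f) v = σ (g v x) y - σ (g v y) x at e3
        rw [← LinearMap.IsAlt.neg hδ.alt (g v y) x, ← sub_eq_add_neg, ← e3, mul_comm])
    refine ⟨hz, mem_stdProlong_succ.2 ⟨fun v => ⟨fun e u => ?_, fun u => ?_⟩, fun v w => ?_⟩⟩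
    · rw [show e = 1 from Subsingleton.elim (α := Equiv.Perm (Fin 1)) e 1]; rfl
    · rw [curryLeft_restrictX]
      have e : (restrictX 1 (onX 1 f v)).curryRight u = g v := by
        refine LinearMap.ext fun x => ?_
        change g v _ = g v x
        congr 1
      exact e ▸ hp v
    · rw [curryLeft_restrictX, curryLeft_restrictX, curryLeft_restrictX, curryLeft_restrictX]
      have h0 : onZ 1 f = (0 : Ambient X 1) := hz
      have := hder.1 v w
      rw [h0, smul_zero, eq_comm, sub_eq_zero] at this
      exact congrArg (restrictX 0) this
  | succ n ih =>
    have hder := tanaka_le_derivations (n + 2) hf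
    -- The bracket `[f z, v] = [f v, z]` vanishes by induction for all `v ∈ X`.
    have hz : onZ (n + 2) f = 0 := by
      refine eq_zero_of_onX_eq_zero T.exists_form_ne_zero
        (tanaka_le_derivations n (onZ_mem_tanaka hf)) (LinearMap.ext fun v => ?_)
      have := hder.2 v
      rw [(ih (onX_mem_tanaka hf v)).1, zero_sub, eq_comm, neg_eq_zero] at this
      exact this
    refine ⟨hz, mem_stdProlong_succ.2 ⟨fun v => ?_, fun v w => ?_⟩⟩
    · rw [curryLeft_restrictX]
      exact (ih (onX_mem_tanaka hf v)).2
    · rw [curryLeft_restrictX, curryLeft_restrictX, curryLeft_restrictX, curryLeft_restrictX]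
      have := hder.1 v w
      rw [hz, smul_zero, eq_comm, sub_eq_zero] at this
      exact congrArg (restrictX (n + 1)) this

end Tableau

end JacobiSymbol

theorem mainTheorem3 {X : Type*} [AddCommGroup X] [Module ℝ X] [Nontrivial X]
    (σ : LinearMap.BilinForm ℝ X) (G : ℤ → Submodule ℝ X) (δ : Submodule ℝ (Module.End ℝ X))
    (hδ : JacobiSymbol.IsSymplecticFlagSymbol σ G δ)
    (D : JacobiSymbol.Diagram) (T : JacobiSymbol.Tableau σ G δ D)
    (h1 : D.Cond1) (h2 : D.Cond2) (h3 : D.Cond3) (h4 : D.Cond4) (i : ℕ) (hi : 0 < i) :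
    Set.InjOn (JacobiSymbol.restrictX (X := X) (i + 1))
      (JacobiSymbol.tanakaProlong σ (JacobiSymbol.uF σ G δ) i) ∧
    (JacobiSymbol.tanakaProlong σ (JacobiSymbol.uF σ G δ) i).map
      (JacobiSymbol.restrictX (i + 1)) = JacobiSymbol.stdProlong T.p i := by
  refine ⟨fun f hf g hg hfg => ?_, le_antisymm ?_ fun t ht => ?_⟩
  · refine sub_eq_zero.1 (JacobiSymbol.eq_zero_of_restrictX_eq_zero T.exists_form_ne_zero (i + 1)
      (Submodule.sub_mem _ hf hg) ?_)
    rw [map_sub, hfg, sub_self]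
  · rintro _ ⟨f, hf, rfl⟩
    obtain ⟨n, rfl⟩ : ∃ n, i = n + 1 := ⟨i - 1, by omega⟩
    exact (T.restrictX_mem_stdProlong hδ h1 h3 h4 n hf).2
  · exact ⟨_, T.extendX_mem_tanaka hδ i ht, JacobiSymbol.restrictX_extendX _ _⟩
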